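/- Let $\mathcal C\subset\mathbb R^n$ be a nonempty, bounded, open convex set (with its Hilbert distance $d_{\mathcal C}$, $(\mathcal C,d_{\mathcal C})$ is called a Hilbert geometry). For $p\in\mathcal C$ and $v\neq 0$ let $p^{+}$ and $p^{-}$ be the points where the rays from $p$ in the directions $v$ and $-v$ meet the boundary $\partial\mathcal C$, and put $$F_{\mathcal C}(p,v)=\tfrac12\|v\|\left(\frac1{\|p-p^-\|}+\frac1{\|p-p^+\|}\right),\qquad F_{\mathcal C}(p,0)=0,\qquad B_{\mathcal C}(p)=\{v: F_{\mathcal C}(p,v)<1\}.$$ The Hilbert measure of $\mathcal C$ is the Borel measure $\mu_{\mathcal C}(A)=\int_A \frac{\omega_n}{\mathrm{vol}(B_{\mathcal C}(p))}\,d\mathrm{vol}(p)$ on $\mathcal C$, where $\mathrm{vol}$ is Lebesgue measure and $\omega_n$ is the volume of the Euclidean open unit ball; it is defined in the same way in any finite-dimensional Euclidean space. The triangle with non-collinear vertices $a,b,c\in\mathbb R^n$ is the open triangle $T=\{\alpha a+\beta b+\gamma c:\ \alpha,\beta,\gamma>0,\ \alpha+\beta+\gamma=1\}$. It is an ideal triangle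 of $(\mathcal C,d_{\mathcal C})$ if $a,b,c\in\partial\mathcal C$ and $T\subset\mathcal C$. Its Hilbert area is then $\mu_{\mathcal C\cap P}(T)\in[0,+\infty]$, where $P$ is the affine plane containing $a,b,c$ and $\mathcal C\cap P$ is regarded as a bounded open convex set of the Euclidean plane $P$. Then: (i) every ideal triangle of $(\mathcal C,d_{\mathcal C})$ has Hilbert area at least $\pi^3/24$; (ii) if $n=2$ and some ideal triangle of $(\mathcal C,d_{\mathcal C})$ has Hilbert area exactly $\pi^3/24$, then $\mathcal C$ is a triangular domain, i.e. $\mathcal C$ is itself an open triangle with non-collinear vertices. -/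

import Mathlib

open scoped ENNReal

namespace HilbertGeometry

/-- A convex domain: the underlying set of a Hilbert geometry. -/
structure IsConvexDomain {E : Type*} [NormedAddCommGroup E] [NormedSpace ℝ E]
    (C : Set E) : Prop where
  nonempty : C.Nonempty
  isOpen : IsOpen C
  convex : Convex ℝ C
  isBounded : Bornology.IsBounded C

/-- The point at which the ray from `p` in the direction `v` leaves `C`. For a convex domain `C`,
a point `p ∈ C` and `v ≠ 0` it is the only point of the boundary on this ray
(see `exitPoint_mem_frontier` and `eq_exitPoint`). -/
noncomputable def exitPoint {E : Type*} [NormedAddCommGroup E] [NormedSpace ℝ E]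
    (C : Set E) (p v : E) : E :=
  p + sSup {t : ℝ | 0 ≤ t ∧ p + t • v ∈ C} • v

/-- The Finsler norm `F_C(p, v)`; the points `p⁺` and `p⁻` at which the line through `p` directed
by `v` meets the boundary are `exitPoint C p v` and `exitPoint C p (-v)`.
For `v = 0` the value is `0` because of the factor `‖v‖`. -/
noncomputable def finsler {E : Type*} [NormedAddCommGroup E] [NormedSpace ℝ E]
    (C : Set E) (p v : E) : ℝ :=
  1 / 2 * ‖v‖ * (1 / ‖p - exitPoint C p (-v)‖ + 1 / ‖p - exitPoint C p v‖)

/-- The open unit ball `B_C(p)` of the norm `F_C(p, ·)`. -/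
def finslerBall {E : Type*} [NormedAddCommGroup E] [NormedSpace ℝ E]
    (C : Set E) (p : E) : Set E :=
  {v | finsler C p v < 1}

/-- The Hilbert measure of `C`: it is carried by `C` and has there the density
`h(p) = ω / vol (B_C(p))` with respect to Lebesgue measure, where `ω` is the volume of the
Euclidean open unit ball. -/
noncomputable def hilbertMeasure {E : Type*} [NormedAddCommGroup E] [InnerProductSpace ℝ E]
    [FiniteDimensional ℝ E] [MeasurableSpace E] [BorelSpace E]
    (C : Set E) : MeasureTheory.Measure E :=
  ((MeasureTheory.volume : MeasureTheory.Measure E).restrict C).withDensity fun p =>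
    (MeasureTheory.volume (Metric.ball (0 : E) 1) : ℝ≥0∞) /
      MeasureTheory.volume (finslerBall C p)

/-- The open triangle with vertices `a`, `b`, `c`: the (relative) interior of their convex hull,
when they are not collinear. -/
def openTriangle {E : Type*} [AddCommGroup E] [Module ℝ E] (a b c : E) : Set E :=
  {x | ∃ α β γ : ℝ, 0 < α ∧ 0 < β ∧ 0 < γ ∧ α + β + γ = 1 ∧ x = α • a + β • b + γ • c}

/-- The open triangle `abc` is an ideal triangle of the Hilbert geometry of `C`. -/
structure IsIdealTriangle {E : Type*} [NormedAddCommGroup E] [NormedSpace ℝ E]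
    (C : Set E) (a b c : E) : Prop where
  affineIndependent : AffineIndependent ℝ ![a, b, c]
  left_mem : a ∈ frontier C
  middle_mem : b ∈ frontier C
  right_mem : c ∈ frontier C
  subset : openTriangle a b c ⊆ C

/-- `S ∩ P`, read in the direction space of the affine subspace `P` by taking the point `o` of `P`
as origin. -/
def planeSection {E : Type*} [AddCommGroup E] [Module ℝ E]
    (P : AffineSubspace ℝ E) (o : E) (S : Set E) : Set P.direction :=
  {v | o + (v : E) ∈ S}

/-- The area of the triangle `abc`: its measure for the Hilbert measure of `C ∩ P`, where `P` is
the affine plane through `a`, `b`, `c`. -/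
noncomputable def triangleArea {E : Type*} [NormedAddCommGroup E] [InnerProductSpace ℝ E]
    [FiniteDimensional ℝ E] [MeasurableSpace E] [BorelSpace E]
    (C : Set E) (a b c : E) : ℝ≥0∞ :=
  hilbertMeasure (planeSection (affineSpan ℝ {a, b, c}) a C)
    (planeSection (affineSpan ℝ {a, b, c}) a (openTriangle a b c))

/-- `C` is a triangular domain: an open triangle with non-collinear vertices. -/
def IsTriangularDomain {E : Type*} [NormedAddCommGroup E] [NormedSpace ℝ E] (C : Set E) : Prop :=
  ∃ a b c : E, AffineIndependent ℝ ![a, b, c] ∧ C = openTriangle a b c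

section ExitPoint

variable {E : Type*} [NormedAddCommGroup E] [NormedSpace ℝ E]

theorem bddAbove_times {C : Set E} (hC : IsConvexDomain C) (p : E) {v : E} (hv : v ≠ 0) :
    BddAbove {t : ℝ | 0 ≤ t ∧ p + t • v ∈ C} := by
  obtain ⟨R, hR⟩ := hC.isBounded.subset_closedBall p
  refine ⟨R / ‖v‖, ?_⟩
  rintro t ⟨ht, htC⟩
  have h := hR htC
  rw [Metric.mem_closedBall, dist_eq_norm, add_sub_cancel_left, norm_smul, Real.norm_eq_abs,
    abs_of_nonneg ht] at h
  exact (le_div_iff₀ (norm_pos_iff.mpr hv)).mpr h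

theorem exitPoint_notMem {C : Set E} (hC : IsConvexDomain C) {p v : E}
    (hp : p ∈ C) (hv : v ≠ 0) : exitPoint C p v ∉ C := by
  intro h
  have hb := bddAbove_times hC p hv
  have hs : 0 ≤ sSup {t : ℝ | 0 ≤ t ∧ p + t • v ∈ C} :=
    le_csSup hb ⟨le_rfl, by simpa using hp⟩
  unfold exitPoint at h
  set s := sSup {t : ℝ | 0 ≤ t ∧ p + t • v ∈ C} with hsdef
  have hcont : Continuous fun t : ℝ => p + t • v := by fun_prop
  have hopen : IsOpen ((fun t : ℝ => p + t • v) ⁻¹' C) := hC.isOpen.preimage hcont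
  obtain ⟨ε, hε, hball⟩ := Metric.isOpen_iff.mp hopen s h
  have hmem : p + (s + ε / 2) • v ∈ C := by
    have h1 : s + ε / 2 ∈ Metric.ball s ε := by
      rw [Metric.mem_ball, Real.dist_eq, add_sub_cancel_left, abs_of_pos (by positivity)]
      linarith
    exact hball h1
  have := le_csSup hb (show s + ε / 2 ∈ {t : ℝ | 0 ≤ t ∧ p + t • v ∈ C} from
    ⟨by positivity, hmem⟩)
  linarith

theorem exitPoint_mem_frontier {C : Set E} (hC : IsConvexDomain C) {p v : E}
    (hp : p ∈ C) (hv : v ≠ 0) : exitPoint C p v ∈ frontier C := by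
  rw [hC.isOpen.frontier_eq]
  refine ⟨?_, exitPoint_notMem hC hp hv⟩
  have hb := bddAbove_times hC p hv
  have hne : {t : ℝ | 0 ≤ t ∧ p + t • v ∈ C}.Nonempty := ⟨0, le_rfl, by simpa using hp⟩
  have hcont : Continuous fun t : ℝ => p + t • v := by fun_prop
  have hmap : Set.MapsTo (fun t : ℝ => p + t • v) {t : ℝ | 0 ≤ t ∧ p + t • v ∈ C} C :=
    fun t ht => ht.2
  exact map_mem_closure (f := fun t : ℝ => p + t • v) hcont (csSup_mem_closure hne hb) hmap

theorem eq_exitPoint {C : Set E} (hC : IsConvexDomain C) {p v : E}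
    (hp : p ∈ C) (hv : v ≠ 0) {t : ℝ} (ht : 0 < t) (h : p + t • v ∈ frontier C) :
    p + t • v = exitPoint C p v := by
  have hb := bddAbove_times hC p hv
  have hne : {t : ℝ | 0 ≤ t ∧ p + t • v ∈ C}.Nonempty := ⟨0, le_rfl, by simpa using hp⟩
  have hs : 0 ≤ sSup {t : ℝ | 0 ≤ t ∧ p + t • v ∈ C} := le_csSup hb ⟨le_rfl, by simpa using hp⟩
  have hex := exitPoint_notMem hC hp hv
  rw [hC.isOpen.frontier_eq] at h
  unfold exitPoint at hex ⊢
  set s := sSup {t : ℝ | 0 ≤ t ∧ p + t • v ∈ C} with hsdef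
  rcases lt_trichotomy t s with hlt | heq | hgt
  · obtain ⟨r, ⟨hr0, hrC⟩, htr⟩ := exists_lt_of_lt_csSup hne hlt
    have h1 := hC.convex.add_smul_sub_mem hp hrC (t := t / r)
      ⟨by positivity, (div_le_one (by linarith)).mpr htr.le⟩
    have hr : r ≠ 0 := by linarith
    rw [add_sub_cancel_left, smul_smul, div_mul_cancel₀ _ hr] at h1
    exact absurd h1 h.2
  · rw [heq]
  · have h1 := hC.convex.add_smul_sub_mem_interior' h.1
      (by rwa [hC.isOpen.interior_eq]) (t := 1 - s / t)
      ⟨by rw [sub_pos]; exact (div_lt_one ht).mpr hgt, by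
        have : 0 ≤ s / t := by positivity
        linarith⟩
    rw [hC.isOpen.interior_eq] at h1
    have h2 : p + t • v + (1 - s / t) • (p - (p + t • v)) = p + s • v := by
      rw [sub_add_cancel_left, smul_neg, smul_smul, add_assoc, ← sub_eq_add_neg, ← sub_smul]
      congr 2
      field_simp
      ring
    rw [h2] at h1
    exact absurd h1 hex

end ExitPoint

end HilbertGeometry

namespace HilbertGeometry

open MeasureTheory Set Filter Topology

/-! ### Integrals over the positive quadrant -/

/-! Shrinking a convex domain enlarges its Finsler norm, shrinks the unit balls and so raises the
density. Normalise the ideal triangle to the standard simplex of the plane, and take a supporting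
line of `C` at each vertex. These give three affine forms, positive on `C`, each vanishing at one
vertex; `C` lies in the region `D` where all three are positive.

If a supporting line contains a side, the density is at least a multiple of the inverse distance to
that side, and the area is infinite (`lintegral_planeDensity_eq_top`).

Otherwise the six remaining vertex values are positive. For `D` the unit ball at `p` is a hexagon
cut out by differences of the logarithmic derivatives of the forms. Its area is at most `12 ℓ₀ℓ₁ℓ₂ /
|det|`, so the density of `C` is at least `(π / 12) |det| / (ℓ₀ℓ₁ℓ₂)`
(`formDensity_le_planeDensity`). A projective map from the positive quadrant to the simplex turns
this bound into `π / 12` times the integral of `(P + Q) / ((P x + Q y) (1 + x) (1 + y))`, with `P`,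
`Q` the two terms of the determinant. Symmetrising in `x` and `y` and using the inequality between
arithmetic and harmonic means reduces this to `P = Q`, where the integral is `π² / 2`
(`le_lintegral_quadrant`). The product is `π³ / 24`.

In the equality case the densities agree at some point `p`, so the ball of `C` fills the hexagon up
to measure zero. A point of `D` outside `C` would leave a nonempty open gap between them
(`eq_forms_of_volume_le`). Hence `C = D`, and a bounded nonempty region cut out by three independent
forms is a triangle. Affine invariance of the Hilbert measure (`hilbertMeasure_image`) carries
everything back to the plane of the triangle. -/

theorem lintegral_Ioi_of_hasDerivAt_of_nonneg {g g' : ℝ → ℝ} {a l : ℝ}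
    (hcont : ContinuousWithinAt g (Ici a) a) (hderiv : ∀ x ∈ Ioi a, HasDerivAt g (g' x) x)
    (hnonneg : ∀ x ∈ Ioi a, 0 ≤ g' x) (hg : Tendsto g atTop (𝓝 l)) :
    ∫⁻ x in Ioi a, ENNReal.ofReal (g' x) = ENNReal.ofReal (l - g a) := by
  rw [← integral_Ioi_of_hasDerivAt_of_nonneg hcont hderiv hnonneg hg,
    ofReal_integral_eq_lintegral_ofReal
      (integrableOn_Ioi_deriv_of_nonneg hcont hderiv hnonneg hg)]
  exact (ae_restrict_iff' measurableSet_Ioi).mpr (Eventually.of_forall hnonneg)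

/-- Partial fractions give the primitive `log ((y + q) / (y + p)) / (p - q)`, which vanishes at
infinity. -/
theorem lintegral_inv_mul_add {p q : ℝ} (hp : 0 < p) (hq : 0 < q) (hpq : p ≠ q) :
    ∫⁻ y in Ioi (0 : ℝ), ENNReal.ofReal (1 / ((y + p) * (y + q))) =
      ENNReal.ofReal ((Real.log p - Real.log q) / (p - q)) := by
  have hpq' : p - q ≠ 0 := sub_ne_zero.mpr hpq
  have hd : ∀ y ∈ Ici (0 : ℝ), HasDerivAt
      (fun y => (Real.log (y + q) - Real.log (y + p)) / (p - q)) (1 / ((y + p) * (y + q))) y := by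
    intro y hy
    have hy : 0 ≤ y := hy
    have h1 : y + p ≠ 0 := by positivity
    have h2 : y + q ≠ 0 := by positivity
    have := ((((hasDerivAt_id y).add_const q).log h2).sub
      (((hasDerivAt_id y).add_const p).log h1)).div_const (p - q)
    convert! this using 1
    simp only [id]
    field_simp
    ring
  rw [lintegral_Ioi_of_hasDerivAt_of_nonneg (l := 0)
    (hd 0 self_mem_Ici).continuousAt.continuousWithinAt (fun y hy => hd y (mem_Ici_of_Ioi hy))]
  · congr 1
    simp only [zero_add]
    field_simp
    ring
  · intro y hy
    have hy : 0 < y := hy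
    positivity
  · have h : Tendsto (fun y : ℝ => 1 + (q - p) * (y + p)⁻¹) atTop (𝓝 (1 + (q - p) * 0)) :=
      ((tendsto_inv_atTop_zero.comp (tendsto_atTop_add_const_right _ p tendsto_id)).const_mul
        _).const_add _
    rw [mul_zero, add_zero] at h
    have h2 := ((Real.continuousAt_log one_ne_zero).tendsto.comp h).div_const (p - q)
    rw [Real.log_one, zero_div] at h2
    refine h2.congr' ?_
    filter_upwards [eventually_gt_atTop 0] with y hy
    have h1 : y + p ≠ 0 := by positivity
    have h2 : y + q ≠ 0 := by positivity
    simp only [Function.comp]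
    rw [← Real.log_div h2 h1]
    congr 2
    field_simp
    ring

theorem lintegral_inv_one_add_mul_sq {w : ℝ} (hw : 0 < w) :
    ∫⁻ z in Ioi (0 : ℝ), ENNReal.ofReal (1 / (1 + z ^ 2 * w)) =
      ENNReal.ofReal (Real.pi / 2 / √w) := by
  have hs : 0 < √w := Real.sqrt_pos.mpr hw
  have hd : ∀ z : ℝ, HasDerivAt (fun z => Real.arctan (√w * z) / √w) (1 / (1 + z ^ 2 * w)) z := by
    intro z
    have := ((((hasDerivAt_id z).const_mul √w).arctan)).div_const √w
    convert! this using 1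
    simp only [id, mul_pow, Real.sq_sqrt hw.le]
    rw [mul_comm w]
    field_simp
  rw [lintegral_Ioi_of_hasDerivAt_of_nonneg (l := Real.pi / 2 / √w)
    (hd 0).continuousAt.continuousWithinAt (fun z _ => hd z)]
  · simp
  · intro z _
    positivity
  · refine Tendsto.div_const ?_ _
    exact (tendsto_nhds_of_tendsto_nhdsWithin Real.tendsto_arctan_atTop).comp
      (tendsto_id.const_mul_atTop hs)

theorem lintegral_inv_sqrt_mul_one_add :
    ∫⁻ w in Ioi (0 : ℝ), ENNReal.ofReal (1 / (√w * (1 + w))) = ENNReal.ofReal Real.pi := by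
  rw [lintegral_Ioi_of_hasDerivAt_of_nonneg (g := fun w => 2 * Real.arctan √w)
    (l := 2 * (Real.pi / 2))]
  · congr 1
    simp only [Real.sqrt_zero, Real.arctan_zero]
    ring
  · exact (by fun_prop : Continuous fun w => 2 * Real.arctan √w).continuousWithinAt
  · intro w hw
    have hw : 0 < w := hw
    have := ((Real.hasDerivAt_sqrt hw.ne').arctan).const_mul 2
    convert! this using 1
    rw [Real.sq_sqrt hw.le]
    have : 0 < √w := Real.sqrt_pos.mpr hw
    field_simp
  · intro w hw
    have hw : 0 < w := hw
    positivity
  · exact ((tendsto_nhds_of_tendsto_nhdsWithin Real.tendsto_arctan_atTop).comp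
      Real.tendsto_sqrt_atTop).const_mul 2

/-- The inner integral is `log z / (z² - 1)`. The same quantity is also an integral over `w` of a
kernel whose `z`-integral is an arctangent, so exchanging `z` and `w` leaves only elementary
integrals. -/
theorem lintegral_lintegral_inv_mul_mul :
    ∫⁻ z in Ioi (0 : ℝ), ∫⁻ y in Ioi (0 : ℝ),
      ENNReal.ofReal (1 / ((y + z) * ((1 + y) * (1 + z)))) =
      ENNReal.ofReal (Real.pi ^ 2 / 4) := by
  -- The partial fractions degenerate at `z = 1`, a null set.
  have hne : ∀ᵐ z : ℝ ∂volume.restrict (Ioi 0), 0 < z ∧ z ≠ 1 := by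
    refine (ae_restrict_mem measurableSet_Ioi).and (ae_restrict_of_ae ?_)
    exact Measure.ae_ne volume 1
  have h1 : ∀ᵐ z : ℝ ∂volume.restrict (Ioi 0), ∫⁻ y in Ioi (0 : ℝ),
      ENNReal.ofReal (1 / ((y + z) * ((1 + y) * (1 + z)))) =
      ∫⁻ w in Ioi (0 : ℝ), ENNReal.ofReal (1 / 2 * (1 / (1 + w)) * (1 / (1 + z ^ 2 * w))) := by
    filter_upwards [hne] with z ⟨hz, hz1⟩
    have e1 : ∀ y ∈ Ioi (0 : ℝ), ENNReal.ofReal (1 / ((y + z) * ((1 + y) * (1 + z)))) =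
        ENNReal.ofReal (1 / (1 + z)) * ENNReal.ofReal (1 / ((y + z) * (y + 1))) := by
      intro y hy
      have hy : 0 < y := hy
      rw [← ENNReal.ofReal_mul (by positivity)]
      congr 1
      field_simp
      ring
    have e2 : ∀ w ∈ Ioi (0 : ℝ),
        ENNReal.ofReal (1 / 2 * (1 / (1 + w)) * (1 / (1 + z ^ 2 * w))) =
        ENNReal.ofReal (1 / (2 * z ^ 2)) *
          ENNReal.ofReal (1 / ((w + 1) * (w + (z ^ 2)⁻¹))) := by
      intro w hw
      have hw : 0 < w := hw
      rw [← ENNReal.ofReal_mul (by positivity)]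
      congr 1
      field_simp
      ring
    have hz2 : z - 1 ≠ 0 := sub_ne_zero.mpr hz1
    have hz3 : z ^ 2 - 1 ≠ 0 := by
      have : z ^ 2 - 1 = (z - 1) * (z + 1) := by ring
      rw [this]
      exact mul_ne_zero hz2 (by positivity)
    have hz4 : 1 ≠ (z ^ 2)⁻¹ := by
      intro h
      apply hz3
      field_simp at h
      linarith
    rw [setLIntegral_congr_fun measurableSet_Ioi e1, setLIntegral_congr_fun measurableSet_Ioi e2,
      lintegral_const_mul' _ _ ENNReal.ofReal_ne_top, lintegral_const_mul' _ _ ENNReal.ofReal_ne_top,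
      lintegral_inv_mul_add hz one_pos hz1, lintegral_inv_mul_add one_pos (by positivity) hz4,
      ← ENNReal.ofReal_mul (by positivity), ← ENNReal.ofReal_mul (by positivity)]
    congr 1
    rw [Real.log_one, Real.log_inv, Real.log_pow]
    have : (1 : ℝ) - (z ^ 2)⁻¹ = (z - 1) * (z + 1) / z ^ 2 := by
      field_simp
      ring
    rw [this]
    have : z + 1 ≠ 0 := by positivity
    have : 1 + z ≠ 0 := by positivity
    field_simp
    push_cast
    ring
  rw [lintegral_congr_ae h1, lintegral_lintegral_swap (by fun_prop)]
  have h2 : ∀ w ∈ Ioi (0 : ℝ), ∫⁻ z in Ioi (0 : ℝ),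
      ENNReal.ofReal (1 / 2 * (1 / (1 + w)) * (1 / (1 + z ^ 2 * w))) =
      ENNReal.ofReal (Real.pi / 4) * ENNReal.ofReal (1 / (√w * (1 + w))) := by
    intro w hw
    have hw : 0 < w := hw
    have hs : 0 < √w := Real.sqrt_pos.mpr hw
    have e : ∀ z ∈ Ioi (0 : ℝ),
        ENNReal.ofReal (1 / 2 * (1 / (1 + w)) * (1 / (1 + z ^ 2 * w))) =
        ENNReal.ofReal (1 / 2 * (1 / (1 + w))) * ENNReal.ofReal (1 / (1 + z ^ 2 * w)) :=
      fun z _ => ENNReal.ofReal_mul (by positivity)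
    rw [setLIntegral_congr_fun measurableSet_Ioi e,
      lintegral_const_mul' _ _ ENNReal.ofReal_ne_top, lintegral_inv_one_add_mul_sq hw,
      ← ENNReal.ofReal_mul (by positivity), ← ENNReal.ofReal_mul (by positivity)]
    congr 1
    field_simp
    ring
  rw [setLIntegral_congr_fun measurableSet_Ioi h2, lintegral_const_mul' _ _ ENNReal.ofReal_ne_top,
    lintegral_inv_sqrt_mul_one_add, ← ENNReal.ofReal_mul (by positivity)]
  congr 1
  ring

theorem le_lintegral_quadrant {P Q : ℝ} (hP : 0 < P) (hQ : 0 < Q) :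
    ENNReal.ofReal (Real.pi ^ 2 / 2) ≤ ∫⁻ x in Ioi (0 : ℝ) ×ˢ Ioi (0 : ℝ),
      ENNReal.ofReal ((P + Q) / ((P * x.1 + Q * x.2) * ((1 + x.1) * (1 + x.2)))) := by
  set f : ℝ → ℝ → ℝ≥0∞ := fun z y =>
    ENNReal.ofReal ((P + Q) / ((P * z + Q * y) * ((1 + z) * (1 + y)))) with hf
  have hfm : Measurable (Function.uncurry f) := by fun_prop
  have hI : ∫⁻ x in Ioi (0 : ℝ) ×ˢ Ioi (0 : ℝ),
      ENNReal.ofReal ((P + Q) / ((P * x.1 + Q * x.2) * ((1 + x.1) * (1 + x.2)))) =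
      ∫⁻ z in Ioi (0 : ℝ), ∫⁻ y in Ioi (0 : ℝ), f z y := by
    rw [Measure.volume_eq_prod, ← Measure.prod_restrict, lintegral_prod _ (by fun_prop)]
  rw [hI]
  have hswap := lintegral_lintegral_swap (μ := volume.restrict (Ioi (0 : ℝ)))
    (ν := volume.restrict (Ioi (0 : ℝ))) (f := f) hfm.aemeasurable
  set I := ∫⁻ z in Ioi (0 : ℝ), ∫⁻ y in Ioi (0 : ℝ), f z y with hIdef
  -- Exchanging the two variables in one copy of `I` symmetrises the integrand.
  have hsum : I + I = ∫⁻ z in Ioi (0 : ℝ), ∫⁻ y in Ioi (0 : ℝ), (f z y + f y z) := by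
    nth_rewrite 2 [hswap]
    rw [hIdef, ← lintegral_add_left' (by fun_prop)]
    refine lintegral_congr fun z => ?_
    rw [← lintegral_add_left' (by fun_prop)]
  have hle : ENNReal.ofReal 4 * ENNReal.ofReal (Real.pi ^ 2 / 4) ≤ I + I := by
    rw [hsum, ← lintegral_lintegral_inv_mul_mul, ← lintegral_const_mul' _ _ ENNReal.ofReal_ne_top]
    refine setLIntegral_mono' measurableSet_Ioi fun z hz => ?_
    rw [← lintegral_const_mul' _ _ ENNReal.ofReal_ne_top]
    refine setLIntegral_mono' measurableSet_Ioi fun y hy => ?_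
    have hy : 0 < y := hy
    have hz : 0 < z := hz
    rw [← ENNReal.ofReal_mul (by positivity), ← ENNReal.ofReal_add (by positivity) (by positivity)]
    refine ENNReal.ofReal_le_ofReal ?_
    -- This is `1 / A + 1 / B ≥ 4 / (A + B)` with an explicit remainder: here `A = P z + Q y` and `B
    -- = P y + Q z` add up to `(P + Q) (y + z)`.
    have e : (P + Q) / ((P * z + Q * y) * ((1 + z) * (1 + y))) +
        (P + Q) / ((P * y + Q * z) * ((1 + y) * (1 + z))) -
        4 * (1 / ((y + z) * ((1 + y) * (1 + z)))) =
        ((P - Q) * (y - z)) ^ 2 /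
          ((P * z + Q * y) * (P * y + Q * z) * (y + z) * ((1 + y) * (1 + z))) := by
      field_simp
      ring
    have : 0 ≤ ((P - Q) * (y - z)) ^ 2 /
          ((P * z + Q * y) * (P * y + Q * z) * (y + z) * ((1 + y) * (1 + z))) := by positivity
    linarith
  rw [← ENNReal.ofReal_mul (by norm_num), ← two_mul] at hle
  have h2 : ENNReal.ofReal (4 * (Real.pi ^ 2 / 4)) = 2 * ENNReal.ofReal (Real.pi ^ 2 / 2) := by
    rw [← ENNReal.ofReal_ofNat 2, ← ENNReal.ofReal_mul (by norm_num)]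
    congr 1
    ring
  rw [h2] at hle
  exact (ENNReal.mul_le_mul_iff_right (by norm_num) (by norm_num)).mp hle

/-! ### The Finsler norm as a symmetrised gauge -/

section Gauge

variable {E : Type*} [NormedAddCommGroup E] [NormedSpace ℝ E]

theorem IsConvexDomain.translate {C : Set E} (hC : IsConvexDomain C) (p : E) :
    IsConvexDomain ((fun v => p + v) ⁻¹' C) where
  nonempty := by
    obtain ⟨x, hx⟩ := hC.nonempty
    exact ⟨x - p, by simpa using hx⟩
  isOpen := hC.isOpen.preimage (by fun_prop)
  convex := hC.convex.translate_preimage_right p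
  isBounded := by
    obtain ⟨R, hR⟩ := hC.isBounded.subset_closedBall p
    refine (Metric.isBounded_closedBall (x := (0 : E)) (r := R)).subset fun v hv => ?_
    simpa [dist_eq_norm] using hR hv

theorem IsConvexDomain.preimage {F : Type*} [NormedAddCommGroup F] [NormedSpace ℝ F]
    {C : Set E} (hC : IsConvexDomain C) (L : F ≃L[ℝ] E) : IsConvexDomain (L ⁻¹' C) where
  nonempty := by
    obtain ⟨x, hx⟩ := hC.nonempty
    exact ⟨L.symm x, by simpa using hx⟩
  isOpen := hC.isOpen.preimage L.continuous
  convex := hC.convex.linear_preimage L.toLinearEquiv.toLinearMap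
  isBounded := by
    have h := L.symm.lipschitz.isBounded_image hC.isBounded
    rwa [L.symm.image_eq_preimage_symm, L.symm_symm] at h

theorem IsConvexDomain.gauge_pos {C : Set E} (hC : IsConvexDomain C) (h0 : 0 ∈ C) {v : E}
    (hv : v ≠ 0) : 0 < gauge C v :=
  (_root_.gauge_pos (absorbent_nhds_zero (hC.isOpen.mem_nhds h0))
    ((NormedSpace.isVonNBounded_iff ℝ).mpr hC.isBounded)).mpr hv

theorem IsConvexDomain.gauge_lt_iff {C : Set E} (hC : IsConvexDomain C) (h0 : 0 ∈ C) {v : E}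
    {r : ℝ} (hr : 0 < r) : gauge C v < r ↔ r⁻¹ • v ∈ C := by
  have h : r⁻¹ • v ∈ {x | gauge C x < 1} ↔ r⁻¹ • v ∈ C := by
    rw [setOfPred_gauge_lt_one_eq_self_of_isOpen hC.convex h0 hC.isOpen]
  rw [← h, mem_ofPred_eq, gauge_smul_of_nonneg (by positivity), smul_eq_mul, inv_mul_lt_iff₀ hr,
    mul_one]

/-- Since `C` is open and convex, the times spent in `C` form a half-open interval ending at the
inverse gauge of the translated domain. -/
theorem sSup_times_eq {C : Set E} (hC : IsConvexDomain C) {p v : E} (hp : p ∈ C) (hv : v ≠ 0) :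
    sSup {t : ℝ | 0 ≤ t ∧ p + t • v ∈ C} = (gauge ((fun v => p + v) ⁻¹' C) v)⁻¹ := by
  have hD := hC.translate p
  have h0 : (0 : E) ∈ (fun v => p + v) ⁻¹' C := by simpa using hp
  have hg := hD.gauge_pos h0 hv
  have : {t : ℝ | 0 ≤ t ∧ p + t • v ∈ C} = Ico 0 (gauge ((fun v => p + v) ⁻¹' C) v)⁻¹ := by
    ext t
    refine and_congr_right fun ht => ?_
    rcases ht.eq_or_lt with rfl | ht
    · simp [hp, hg]
    · have := hD.gauge_lt_iff h0 (v := v) (inv_pos.mpr ht)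
      rw [inv_inv] at this
      rw [lt_inv_comm₀ ht hg, this, mem_preimage]
  rw [this, csSup_Ico (inv_pos.mpr hg)]

theorem finsler_eq_gauge {C : Set E} (hC : IsConvexDomain C) {p : E} (hp : p ∈ C) (v : E) :
    finsler C p v = (gauge ((fun v => p + v) ⁻¹' C) v + gauge ((fun v => p + v) ⁻¹' C) (-v)) / 2 := by
  rcases eq_or_ne v 0 with rfl | hv
  · simp [finsler]
  have h0 : (0 : E) ∈ (fun v => p + v) ⁻¹' C := by simpa using hp
  have key : ∀ w : E, w ≠ 0 → ‖w‖ * (1 / ‖p - exitPoint C p w‖) =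
      gauge ((fun v => p + v) ⁻¹' C) w := by
    intro w hw
    have hg := (hC.translate p).gauge_pos h0 hw
    have hw' := norm_pos_iff.mpr hw
    rw [exitPoint, sSup_times_eq hC hp hw, sub_add_cancel_left, norm_neg, norm_smul,
      norm_inv, Real.norm_of_nonneg hg.le]
    field_simp
  rw [← key v hv, ← key (-v) (neg_ne_zero.mpr hv), finsler, norm_neg]
  ring

theorem continuous_finsler {C : Set E} (hC : IsConvexDomain C) {p : E} (hp : p ∈ C) :
    Continuous (finsler C p) := by
  have hn : (fun v => p + v) ⁻¹' C ∈ 𝓝 (0 : E) :=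
    (hC.translate p).isOpen.mem_nhds (by simpa using hp)
  have hg := continuous_gauge (hC.translate p).convex hn
  rw [funext (finsler_eq_gauge hC hp)]
  fun_prop

theorem finsler_smul {C : Set E} (hC : IsConvexDomain C) {p : E} (hp : p ∈ C) {r : ℝ}
    (hr : 0 ≤ r) (v : E) : finsler C p (r • v) = r * finsler C p v := by
  rw [finsler_eq_gauge hC hp, finsler_eq_gauge hC hp, ← smul_neg, gauge_smul_of_nonneg hr,
    gauge_smul_of_nonneg hr, smul_eq_mul, smul_eq_mul]
  ring

/-- The condition is `g(v) + g(-v) < 2` for the gauge `g` at `p`; the number `r` splits the budget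
`2` between the two terms. This turns membership into two conditions on points of `C`, which serve
both measurability and comparison. -/
theorem mem_finslerBall_iff {C : Set E} (hC : IsConvexDomain C) {p : E} (hp : p ∈ C) {v : E} :
    v ∈ finslerBall C p ↔
      ∃ r ∈ Ioo (0 : ℝ) 2, p + r⁻¹ • v ∈ C ∧ p + (2 - r)⁻¹ • (-v) ∈ C := by
  have hD := hC.translate p
  have h0 : (0 : E) ∈ (fun v => p + v) ⁻¹' C := by simpa using hp
  rw [finslerBall, mem_ofPred_eq, finsler_eq_gauge hC hp]
  have h1 := gauge_nonneg (s := (fun v => p + v) ⁻¹' C) v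
  have h2 := gauge_nonneg (s := (fun v => p + v) ⁻¹' C) (-v)
  constructor
  · intro h
    set g := gauge ((fun v => p + v) ⁻¹' C) v with hg
    set g' := gauge ((fun v => p + v) ⁻¹' C) (-v) with hg'
    -- The midpoint of the interval from `g` to `2 - g'`.
    refine ⟨(g + 2 - g') / 2, ⟨by linarith, by linarith⟩, ?_, ?_⟩
    · exact (hD.gauge_lt_iff h0 (by linarith)).mp (by linarith)
    · exact (hD.gauge_lt_iff h0 (by linarith)).mp (by linarith)
  · rintro ⟨r, hr, ha, hb⟩
    have h3 := (hD.gauge_lt_iff h0 hr.1).mpr ha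
    have h4 := (hD.gauge_lt_iff h0 (sub_pos.mpr hr.2)).mpr hb
    linarith

theorem isOpen_finslerBall_total {C : Set E} (hC : IsConvexDomain C) :
    IsOpen {x : E × E | x.1 ∈ C ∧ x.2 ∈ finslerBall C x.1} := by
  have : {x : E × E | x.1 ∈ C ∧ x.2 ∈ finslerBall C x.1} =
      ⋃ r ∈ Ioo (0 : ℝ) 2, {x : E × E | x.1 ∈ C ∧ x.1 + r⁻¹ • x.2 ∈ C ∧
        x.1 + (2 - r)⁻¹ • (-x.2) ∈ C} := by
    ext x
    simp only [mem_ofPred_eq, mem_iUnion, exists_prop]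
    constructor
    · rintro ⟨hx, hB⟩
      obtain ⟨r, hr, h⟩ := (mem_finslerBall_iff hC hx).mp hB
      exact ⟨r, hr, hx, h⟩
    · rintro ⟨r, hr, hx, h⟩
      exact ⟨hx, (mem_finslerBall_iff hC hx).mpr ⟨r, hr, h⟩⟩
  rw [this]
  refine isOpen_biUnion fun r _ => ?_
  exact (hC.isOpen.preimage continuous_fst).inter
    ((hC.isOpen.preimage (by fun_prop : Continuous fun x : E × E => x.1 + r⁻¹ • x.2)).inter
      (hC.isOpen.preimage (by fun_prop : Continuous fun x : E × E => x.1 + (2 - r)⁻¹ • (-x.2))))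

theorem gauge_preimage_equiv {F : Type*} [NormedAddCommGroup F] [NormedSpace ℝ F] (s : Set E)
    (L : F ≃L[ℝ] E) (v : F) : gauge (L ⁻¹' s) v = gauge s (L v) := by
  simp [gauge_def']

theorem finslerBall_preimage {F : Type*} [NormedAddCommGroup F] [NormedSpace ℝ F] {C : Set E}
    (hC : IsConvexDomain C) (L : F ≃L[ℝ] E) {q : F} (hq : L q ∈ C) :
    finslerBall (L ⁻¹' C) q = L ⁻¹' finslerBall C (L q) := by
  ext v
  have h : (fun v => q + v) ⁻¹' (L ⁻¹' C) = L ⁻¹' ((fun v => L q + v) ⁻¹' C) := by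
    ext w
    simp
  simp only [finslerBall, mem_preimage, mem_ofPred_eq]
  rw [finsler_eq_gauge (hC.preimage L) hq, finsler_eq_gauge hC hq, h, gauge_preimage_equiv,
    gauge_preimage_equiv, map_neg]

end Gauge

/-! ### Comparison with the Hilbert geometry of three half-planes -/

/-- The affine form on the plane whose coefficients are the row `i` of `N`. -/
def affineForm (N : Matrix (Fin 3) (Fin 3) ℝ) (i : Fin 3) (q : ℝ × ℝ) : ℝ :=
  N i 0 + N i 1 * q.1 + N i 2 * q.2

/-- The logarithmic derivative at `q` of the affine form `affineForm N i` in the direction `v`. -/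
noncomputable def logSlope (N : Matrix (Fin 3) (Fin 3) ℝ) (i : Fin 3) (q v : ℝ × ℝ) : ℝ :=
  (N i 1 * v.1 + N i 2 * v.2) / affineForm N i q

theorem affineForm_add_smul (N : Matrix (Fin 3) (Fin 3) ℝ) (i : Fin 3) {q : ℝ × ℝ}
    (hq : affineForm N i q ≠ 0) (r : ℝ) (v : ℝ × ℝ) :
    affineForm N i (q + r • v) = affineForm N i q * (1 + r * logSlope N i q v) := by
  simp only [logSlope]
  field_simp
  simp [affineForm]
  ring

theorem logSlope_smul (N : Matrix (Fin 3) (Fin 3) ℝ) (i : Fin 3) (q : ℝ × ℝ) (r : ℝ)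
    (v : ℝ × ℝ) : logSlope N i q (r • v) = r * logSlope N i q v := by
  simp [logSlope]
  ring

theorem continuous_logSlope (N : Matrix (Fin 3) (Fin 3) ℝ) (i : Fin 3) (q : ℝ × ℝ) :
    Continuous (logSlope N i q) := by
  unfold logSlope
  fun_prop

theorem volume_hexagon_le : volume {x : ℝ × ℝ | |x.1| < 2 ∧ |x.2| < 2 ∧ |x.1 - x.2| < 2} ≤
    ENNReal.ofReal 12 := by
  have hsub : {x : ℝ × ℝ | |x.1| < 2 ∧ |x.2| < 2 ∧ |x.1 - x.2| < 2} ⊆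
      regionBetween (fun x => max (-2) (x - 2)) (fun x => min 2 (x + 2)) (Ioc (-2) 2) := by
    rintro ⟨x, y⟩ ⟨h1, h2, h3⟩
    simp only [abs_lt] at h1 h2 h3
    refine ⟨⟨h1.1, h1.2.le⟩, ?_, ?_⟩
    · exact max_lt h2.1 (by linarith)
    · exact lt_min h2.2 (by linarith)
  refine (measure_mono hsub).trans ?_
  rw [Measure.volume_eq_prod, volume_regionBetween_eq_lintegral (by fun_prop) (by fun_prop)
    measurableSet_Ioc]
  -- The vertical section of the hexagon at `x` has length `4 - |x|`, so the area is `16 - 4 = 12`.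
  have e : ∀ x ∈ Ioc (-2 : ℝ) 2, ENNReal.ofReal
      (((fun x => min 2 (x + 2)) - (fun x => max (-2) (x - 2)) : ℝ → ℝ) x) =
      ENNReal.ofReal (4 - |x|) := by
    intro x _
    congr 1
    simp only [Pi.sub_apply]
    rcases le_total 0 x with h | h
    · rw [abs_of_nonneg h, min_eq_left (by linarith), max_eq_right (by linarith)]
      ring
    · rw [abs_of_nonpos h, min_eq_right (by linarith), max_eq_left (by linarith)]
      ring
  rw [setLIntegral_congr_fun measurableSet_Ioc e, ← ofReal_integral_eq_lintegral_ofReal]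
  · refine ENNReal.ofReal_le_ofReal ?_
    rw [← intervalIntegral.integral_of_le (by norm_num),
      intervalIntegral.integral_sub (by simp) (continuous_abs.intervalIntegrable _ _)]
    have h1 : ∫ x in (-2 : ℝ)..0, |x| = ∫ x in (-2 : ℝ)..0, -x := by
      refine intervalIntegral.integral_congr fun x hx => ?_
      rw [uIcc_of_le (by norm_num)] at hx
      exact abs_of_nonpos hx.2
    have h2 : ∫ x in (0 : ℝ)..2, |x| = ∫ x in (0 : ℝ)..2, x := by
      refine intervalIntegral.integral_congr fun x hx => ?_
      rw [uIcc_of_le (by norm_num)] at hx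
      exact abs_of_nonneg hx.1
    rw [← intervalIntegral.integral_add_adjacent_intervals
      (continuous_abs.intervalIntegrable (-2) 0) (continuous_abs.intervalIntegrable 0 2), h1, h2,
      intervalIntegral.integral_neg, integral_id, integral_id]
    simp
    norm_num
  · exact ((by fun_prop : Continuous fun x : ℝ => 4 - |x|).integrableOn_Icc).mono_set
      Ioc_subset_Icc_self
  · refine (ae_restrict_iff' measurableSet_Ioc).mpr (Eventually.of_forall fun x hx => ?_)
    have : |x| ≤ 2 := abs_le.mpr ⟨hx.1.le, hx.2⟩
    simp only [Pi.zero_apply]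
    linarith

/-- The differences of logarithmic slopes with the third one are linear coordinates on the tangent
plane in which the set becomes a fixed hexagon. Row and column operations on `N` give the
determinant `N.det / (ℓ₀ℓ₁ℓ₂)` for this change of coordinates. -/
theorem volume_logSlope_le {N : Matrix (Fin 3) (Fin 3) ℝ} (hN : N.det ≠ 0) {q : ℝ × ℝ}
    (hq : ∀ i, 0 < affineForm N i q) :
    volume {v : ℝ × ℝ | ∀ i j, logSlope N i q v - logSlope N j q v < 2} ≤
      ENNReal.ofReal (12 * (affineForm N 0 q * affineForm N 1 q * affineForm N 2 q) / |N.det|) := by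
  set D := affineForm N 0 q * affineForm N 1 q * affineForm N 2 q with hD
  have h0 := hq 0
  have h1 := hq 1
  have h2 := hq 2
  have hDpos : 0 < D := by positivity
  let f : ℝ × ℝ →ₗ[ℝ] ℝ × ℝ := Matrix.toLin (.finTwoProd ℝ) (.finTwoProd ℝ)
    !![N 0 1 / affineForm N 0 q - N 2 1 / affineForm N 2 q,
      N 0 2 / affineForm N 0 q - N 2 2 / affineForm N 2 q;
      N 1 1 / affineForm N 1 q - N 2 1 / affineForm N 2 q,
      N 1 2 / affineForm N 1 q - N 2 2 / affineForm N 2 q]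
  have hdet : LinearMap.det f = N.det / D := by
    rw [LinearMap.det_toLin, Matrix.det_fin_two_of, Matrix.det_fin_three, hD]
    field_simp
    simp only [affineForm]
    ring
  have hdet0 : LinearMap.det f ≠ 0 := by
    rw [hdet]
    positivity
  have hf : ∀ v, f v = (logSlope N 0 q v - logSlope N 2 q v,
      logSlope N 1 q v - logSlope N 2 q v) := by
    rintro ⟨x, y⟩
    simp only [f, Matrix.toLin_finTwoProd_apply, logSlope]
    ext <;> simp <;> ring
  have hsub : {v : ℝ × ℝ | ∀ i j, logSlope N i q v - logSlope N j q v < 2} ⊆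
      f ⁻¹' {x : ℝ × ℝ | |x.1| < 2 ∧ |x.2| < 2 ∧ |x.1 - x.2| < 2} := by
    intro v hv
    simp only [mem_preimage, hf, mem_ofPred_eq, abs_lt]
    have := hv 0 1
    have := hv 1 0
    have := hv 0 2
    have := hv 2 0
    have := hv 1 2
    have := hv 2 1
    refine ⟨⟨?_, ?_⟩, ⟨?_, ?_⟩, ⟨?_, ?_⟩⟩ <;> linarith
  refine (measure_mono hsub).trans ?_
  rw [Measure.addHaar_preimage_linearMap _ hdet0]
  refine (mul_le_mul_right volume_hexagon_le _).trans_eq ?_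
  rw [← ENNReal.ofReal_mul (abs_nonneg _), hdet, inv_div, abs_div, abs_of_pos hDpos]
  congr 1
  ring

/-- Positivity of form `j` at the forward point gives `r + l_j > 0`, and positivity of form `i` at
the backward point gives `(2 - r) - l_i > 0`; add the two. -/
theorem finslerBall_subset_logSlope {C : Set (ℝ × ℝ)} (hC : IsConvexDomain C)
    {N : Matrix (Fin 3) (Fin 3) ℝ} (hN : ∀ q ∈ C, ∀ i, 0 < affineForm N i q) {p : ℝ × ℝ}
    (hp : p ∈ C) :
    finslerBall C p ⊆ {v : ℝ × ℝ | ∀ i j, logSlope N i p v - logSlope N j p v < 2} := by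
  intro v hv i j
  obtain ⟨r, ⟨hr0, hr2⟩, h1, h2⟩ := (mem_finslerBall_iff hC hp).mp hv
  have hr2 : 0 < 2 - r := by linarith
  have hj := hN _ h1 j
  have hi := hN _ h2 i
  rw [affineForm_add_smul _ _ (hN p hp j).ne'] at hj
  rw [smul_neg, ← neg_smul, affineForm_add_smul _ _ (hN p hp i).ne'] at hi
  have hj := (mul_pos_iff_of_pos_left (hN p hp j)).mp hj
  have hi := (mul_pos_iff_of_pos_left (hN p hp i)).mp hi
  have hj' : 0 < r * (1 + r⁻¹ * logSlope N j p v) := by positivity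
  have hi' : 0 < (2 - r) * (1 + -(2 - r)⁻¹ * logSlope N i p v) := by positivity
  have e1 : r * (1 + r⁻¹ * logSlope N j p v) = r + logSlope N j p v := by
    field_simp
  have e2 : (2 - r) * (1 + -(2 - r)⁻¹ * logSlope N i p v) = (2 - r) - logSlope N i p v := by
    field_simp
    ring
  linarith

/-- The density of the Hilbert measure of a domain of the plane. -/
noncomputable def planeDensity (C : Set (ℝ × ℝ)) (p : ℝ × ℝ) : ℝ≥0∞ :=
  ENNReal.ofReal Real.pi / volume (finslerBall C p)

/-- The density of the Hilbert measure of the domain where three affine forms are positive. -/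
noncomputable def formDensity (N : Matrix (Fin 3) (Fin 3) ℝ) (p : ℝ × ℝ) : ℝ :=
  Real.pi / 12 * (|N.det| / (affineForm N 0 p * affineForm N 1 p * affineForm N 2 p))

theorem formDensity_le_div {N : Matrix (Fin 3) (Fin 3) ℝ} (hN : N.det ≠ 0) {q : ℝ × ℝ}
    (hq : ∀ i, 0 < affineForm N i q) :
    ENNReal.ofReal (formDensity N q) ≤ ENNReal.ofReal Real.pi /
      volume {v : ℝ × ℝ | ∀ i j, logSlope N i q v - logSlope N j q v < 2} := by
  have h0 := hq 0
  have h1 := hq 1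
  have h2 := hq 2
  have hd := abs_pos.mpr hN
  refine le_trans ?_ (ENNReal.div_le_div_left (volume_logSlope_le hN hq) _)
  rw [← ENNReal.ofReal_div_of_pos (by positivity)]
  refine ENNReal.ofReal_le_ofReal (le_of_eq ?_)
  rw [formDensity]
  field_simp

theorem formDensity_le_planeDensity {C : Set (ℝ × ℝ)} (hC : IsConvexDomain C)
    {N : Matrix (Fin 3) (Fin 3) ℝ} (hdet : N.det ≠ 0)
    (hN : ∀ q ∈ C, ∀ i, 0 < affineForm N i q) {p : ℝ × ℝ} (hp : p ∈ C) :
    ENNReal.ofReal (formDensity N p) ≤ planeDensity C p :=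
  (formDensity_le_div hdet (hN p hp)).trans
    (ENNReal.div_le_div_left (measure_mono (finslerBall_subset_logSlope hC hN hp)) _)

/-- The balls are the slices of an open subset of the product, so their volumes depend measurably on
the point. -/
theorem aemeasurable_planeDensity {C : Set (ℝ × ℝ)} (hC : IsConvexDomain C) :
    AEMeasurable (planeDensity C) (volume.restrict C) := by
  have h := measurable_measure_prodMk_left (ν := (volume : Measure (ℝ × ℝ)))
    (isOpen_finslerBall_total hC).measurableSet
  refine ⟨_, h.const_div (ENNReal.ofReal Real.pi), ?_⟩
  filter_upwards [ae_restrict_mem hC.isOpen.measurableSet] with p hp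
  simp only [planeDensity]
  congr 2
  ext v
  simp [hp]

/-! ### The standard open simplex of the plane -/

/-- The open triangle with vertices `(0, 0)`, `(1, 0)`, `(0, 1)`. -/
def planeSimplex : Set (ℝ × ℝ) := {q | 0 < q.1 ∧ 0 < q.2 ∧ q.1 + q.2 < 1}

theorem isOpen_planeSimplex : IsOpen planeSimplex :=
  (isOpen_lt continuous_const continuous_fst).inter
    ((isOpen_lt continuous_const continuous_snd).inter
      (isOpen_lt (continuous_fst.add continuous_snd) continuous_const))

theorem mem_closure_planeSimplex {q : ℝ × ℝ} (h1 : 0 ≤ q.1) (h2 : 0 ≤ q.2) (h : q.1 + q.2 ≤ 1) :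
    q ∈ closure planeSimplex := by
  -- The path moves `q` towards the barycentre `(1/3, 1/3)` with weight `3 t`.
  have ht : Tendsto (fun t : ℝ => (1 - 3 * t) • q + t • ((1, 1) : ℝ × ℝ)) (𝓝[>] 0) (𝓝 q) := by
    have : Continuous fun t : ℝ => (1 - 3 * t) • q + t • ((1, 1) : ℝ × ℝ) := by fun_prop
    have := this.tendsto 0
    simp only [mul_zero, sub_zero, one_smul, zero_smul, add_zero] at this
    exact this.mono_left nhdsWithin_le_nhds
  refine mem_closure_of_tendsto ht ?_
  filter_upwards [Ioo_mem_nhdsGT (show (0 : ℝ) < 1 / 3 by norm_num)] with t ⟨ht0, ht1⟩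
  have h3 : 0 < 1 - 3 * t := by linarith
  simp only [planeSimplex, mem_ofPred_eq, Prod.fst_add, Prod.smul_fst, smul_eq_mul, Prod.snd_add,
    Prod.smul_snd]
  refine ⟨by positivity, by positivity, ?_⟩
  nlinarith [mul_le_mul_of_nonneg_left h h3.le]

/-! ### Divergence at a side -/

theorem lintegral_Ioo_inv_eq_top {b : ℝ} (hb : 0 < b) :
    ∫⁻ z in Ioo 0 b, ENNReal.ofReal z⁻¹ = ∞ := by
  by_contra h
  have h1 : IntegrableOn (fun z : ℝ => z⁻¹) (Ioo 0 b) := by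
    refine (lintegral_ofReal_ne_top_iff_integrable (by fun_prop) ?_).mp h
    filter_upwards [ae_restrict_mem measurableSet_Ioo] with z hz
    exact (inv_pos.mpr hz.1).le
  have h2 : IntervalIntegrable (fun z : ℝ => z⁻¹) volume 0 b :=
    (intervalIntegrable_iff_integrableOn_Ioo_of_le hb.le).mpr h1
  rw [intervalIntegrable_inv_iff] at h2
  rcases h2 with h2 | h2
  · exact hb.ne h2
  · exact h2 left_mem_uIcc

theorem lintegral_simplex_inv_snd : ∫⁻ q in planeSimplex, ENNReal.ofReal q.2⁻¹ = ∞ := by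
  have hsub : Ioo (0 : ℝ) (1 / 2) ×ˢ Ioo (0 : ℝ) (1 / 2) ⊆ planeSimplex := by
    rintro ⟨y, z⟩ ⟨hy, hz⟩
    exact ⟨hy.1, hz.1, by linarith [hy.2, hz.2]⟩
  rw [eq_top_iff]
  refine le_trans ?_ (lintegral_mono_set hsub)
  rw [Measure.volume_eq_prod, ← Measure.prod_restrict, lintegral_prod _ (by fun_prop)]
  simp only [lintegral_Ioo_inv_eq_top (show (0 : ℝ) < 1 / 2 by norm_num), lintegral_const]
  simp

theorem lintegral_simplex_inv_fst : ∫⁻ q in planeSimplex, ENNReal.ofReal q.1⁻¹ = ∞ := by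
  rw [← lintegral_simplex_inv_snd, ← lintegral_indicator isOpen_planeSimplex.measurableSet,
    ← lintegral_indicator isOpen_planeSimplex.measurableSet, Measure.volume_eq_prod,
    ← lintegral_prod_swap]
  refine lintegral_congr fun q => ?_
  have : q.swap ∈ planeSimplex ↔ q ∈ planeSimplex := by
    simp only [planeSimplex, mem_ofPred_eq, Prod.fst_swap, Prod.snd_swap, add_comm q.2]
    tauto
  by_cases h : q ∈ planeSimplex
  · rw [indicator_of_mem h, indicator_of_mem (this.mpr h), Prod.fst_swap]
  · rw [indicator_of_notMem h, indicator_of_notMem (mt this.mp h)]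

theorem lintegral_simplex_inv_one_sub :
    ∫⁻ q in planeSimplex, ENNReal.ofReal (1 - q.1 - q.2)⁻¹ = ∞ := by
  have hm := isOpen_planeSimplex.measurableSet
  rw [← lintegral_simplex_inv_snd, ← lintegral_indicator hm, ← lintegral_indicator hm,
    Measure.volume_eq_prod, lintegral_prod _ ((by fun_prop : Measurable fun q : ℝ × ℝ =>
      ENNReal.ofReal (1 - q.1 - q.2)⁻¹).indicator hm).aemeasurable,
    lintegral_prod _ ((by fun_prop : Measurable fun q : ℝ × ℝ =>
      ENNReal.ofReal q.2⁻¹).indicator hm).aemeasurable]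
  refine lintegral_congr fun y => ?_
  -- The reflection `z ↦ 1 - y - z` preserves each vertical section and exchanges the slanted side
  -- with the horizontal one.
  rw [← lintegral_sub_left_eq_self _ (1 - y)]
  refine lintegral_congr fun z => ?_
  have : (y, 1 - y - z) ∈ planeSimplex ↔ (y, z) ∈ planeSimplex := by
    simp only [planeSimplex, mem_ofPred_eq]
    constructor <;> rintro ⟨h1, h2, h3⟩ <;> refine ⟨h1, ?_, ?_⟩ <;> linarith
  by_cases h : (y, z) ∈ planeSimplex
  · rw [indicator_of_mem (this.mpr h), indicator_of_mem h]
    simp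
  · rw [indicator_of_notMem (mt this.mp h), indicator_of_notMem h]

theorem lintegral_formDensity_eq_top {N : Matrix (Fin 3) (Fin 3) ℝ} (hdet : N.det ≠ 0)
    (hN : ∀ q ∈ planeSimplex, ∀ i, 0 < affineForm N i q) {M : ℝ}
    (h1 : ∀ q ∈ planeSimplex, affineForm N 1 q ≤ M) (h2 : ∀ q ∈ planeSimplex, affineForm N 2 q ≤ M)
    (htop : ∫⁻ q in planeSimplex, ENNReal.ofReal (affineForm N 0 q)⁻¹ = ∞) :
    ∫⁻ q in planeSimplex, ENNReal.ofReal (formDensity N q) = ∞ := by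
  have hM : 0 < M := by
    have hq : ((1 / 3, 1 / 3) : ℝ × ℝ) ∈ planeSimplex := by norm_num [planeSimplex]
    exact (hN _ hq 1).trans_le (h1 _ hq)
  have hd := abs_pos.mpr hdet
  have hκ : 0 < Real.pi / 12 * |N.det| / (M * M) := by positivity
  rw [eq_top_iff]
  calc ∞ = ENNReal.ofReal (Real.pi / 12 * |N.det| / (M * M)) *
        ∫⁻ q in planeSimplex, ENNReal.ofReal (affineForm N 0 q)⁻¹ := by
          rw [htop, ENNReal.mul_top (ENNReal.ofReal_pos.mpr hκ).ne']
    _ ≤ _ := by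
      rw [← lintegral_const_mul' _ _ ENNReal.ofReal_ne_top]
      refine setLIntegral_mono' isOpen_planeSimplex.measurableSet fun q hq => ?_
      have e0 := hN q hq 0
      have e1 := hN q hq 1
      have e2 := hN q hq 2
      rw [← ENNReal.ofReal_mul hκ.le]
      refine ENNReal.ofReal_le_ofReal ?_
      have : Real.pi / 12 * |N.det| / (M * M) * (affineForm N 0 q)⁻¹ =
          Real.pi / 12 * (|N.det| / (affineForm N 0 q * M * M)) := by
        field_simp
      rw [this, formDensity]
      have := h1 q hq
      have := h2 q hq
      gcongr

/-! ### The projective change of variables -/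

/-- The projective map of the positive quadrant onto the simplex. -/
noncomputable def quadrantMap (s t : ℝ) (x : ℝ × ℝ) : ℝ × ℝ :=
  (s * x.1 / (1 + s * x.1 + t * x.2), t * x.2 / (1 + s * x.1 + t * x.2))

/-- The derivative of `quadrantMap`. -/
noncomputable def quadrantMapDeriv (s t : ℝ) (x : ℝ × ℝ) : ℝ × ℝ →L[ℝ] ℝ × ℝ :=
  (Matrix.toLin (.finTwoProd ℝ) (.finTwoProd ℝ)
    !![s * (1 + t * x.2) / (1 + s * x.1 + t * x.2) ^ 2,
      -(s * x.1 * t) / (1 + s * x.1 + t * x.2) ^ 2;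
      -(t * x.2 * s) / (1 + s * x.1 + t * x.2) ^ 2,
      t * (1 + s * x.1) / (1 + s * x.1 + t * x.2) ^ 2]).toContinuousLinearMap

theorem det_quadrantMapDeriv {s t : ℝ} {x : ℝ × ℝ} (hx : 1 + s * x.1 + t * x.2 ≠ 0) :
    (quadrantMapDeriv s t x).det = s * t / (1 + s * x.1 + t * x.2) ^ 3 := by
  unfold quadrantMapDeriv
  simp only [LinearMap.det_toContinuousLinearMap, LinearMap.det_toLin, Matrix.det_fin_two_of]
  field_simp
  ring

theorem hasFDerivAt_quadrantMap {s t : ℝ} {x : ℝ × ℝ} (hx : 1 + s * x.1 + t * x.2 ≠ 0) :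
    HasFDerivAt (quadrantMap s t) (quadrantMapDeriv s t x) x := by
  unfold quadrantMapDeriv
  have h1 : HasFDerivAt (fun x : ℝ × ℝ => s * x.1) (s • ContinuousLinearMap.fst ℝ ℝ ℝ) x :=
    hasFDerivAt_fst.const_mul s
  have h2 : HasFDerivAt (fun x : ℝ × ℝ => t * x.2) (t • ContinuousLinearMap.snd ℝ ℝ ℝ) x :=
    hasFDerivAt_snd.const_mul t
  have hw := (hasDerivAt_inv hx).comp_hasFDerivAt x ((h1.const_add 1).fun_add h2)
  have hq : quadrantMap s t = fun x => (s * x.1 * (1 + s * x.1 + t * x.2)⁻¹,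
      t * x.2 * (1 + s * x.1 + t * x.2)⁻¹) := by
    funext x
    simp only [quadrantMap, div_eq_mul_inv]
  rw [hq]
  refine ((h1.fun_mul hw).prodMk (h2.fun_mul hw)).congr_fderiv ?_
  ext <;> simp [Matrix.toLin_finTwoProd_apply] <;> field_simp <;> ring

theorem quadrantMap_mem {s t : ℝ} (hs : 0 < s) (ht : 0 < t) {x : ℝ × ℝ}
    (hx : x ∈ Ioi (0 : ℝ) ×ˢ Ioi (0 : ℝ)) : quadrantMap s t x ∈ planeSimplex := by
  obtain ⟨h1, h2⟩ : 0 < x.1 ∧ 0 < x.2 := hx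
  refine ⟨by simp only [quadrantMap]; positivity, by simp only [quadrantMap]; positivity, ?_⟩
  simp only [quadrantMap]
  rw [← add_div, div_lt_one (by positivity)]
  linarith

theorem injOn_quadrantMap {s t : ℝ} (hs : 0 < s) (ht : 0 < t) :
    InjOn (quadrantMap s t) (Ioi (0 : ℝ) ×ˢ Ioi (0 : ℝ)) := by
  rintro ⟨y, z⟩ ⟨hy, hz⟩ ⟨y', z'⟩ ⟨hy', hz'⟩ h
  simp only [mem_Ioi] at hy hz hy' hz'
  simp only [quadrantMap, Prod.mk.injEq] at h
  obtain ⟨h1, h2⟩ := h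
  have hw : 0 < 1 + s * y + t * z := by positivity
  have hw' : 0 < 1 + s * y' + t * z' := by positivity
  have e : 1 / (1 + s * y + t * z) = 1 / (1 + s * y' + t * z') := by
    have a1 : 1 / (1 + s * y + t * z) =
        1 - s * y / (1 + s * y + t * z) - t * z / (1 + s * y + t * z) := by
      field_simp
      ring
    have a2 : 1 / (1 + s * y' + t * z') =
        1 - s * y' / (1 + s * y' + t * z') - t * z' / (1 + s * y' + t * z') := by
      field_simp
      ring
    rw [a1, a2, h1, h2]
  have e' : 1 + s * y + t * z = 1 + s * y' + t * z' := by
    rwa [div_eq_div_iff hw.ne' hw'.ne', one_mul, one_mul, eq_comm] at e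
  rw [e', div_left_inj' hw'.ne', mul_right_inj' hs.ne'] at h1
  rw [e', div_left_inj' hw'.ne', mul_right_inj' ht.ne'] at h2
  rw [h1, h2]

/-- The affine forms with values `(0, b₁, c₁)`, `(a₂, 0, c₂)`, `(a₃, b₃, 0)` at the vertices of
the simplex. -/
def vertexForms (b₁ c₁ a₂ c₂ a₃ b₃ : ℝ) : Matrix (Fin 3) (Fin 3) ℝ :=
  !![0, b₁, c₁; a₂, -a₂, c₂ - a₂; a₃, b₃ - a₃, -a₃]

theorem det_vertexForms (b₁ c₁ a₂ c₂ a₃ b₃ : ℝ) :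
    (vertexForms b₁ c₁ a₂ c₂ a₃ b₃).det = b₁ * c₂ * a₃ + c₁ * a₂ * b₃ := by
  rw [Matrix.det_fin_three]
  simp [vertexForms]
  ring

/-- The Jacobian `s t / w³` cancels the common denominators `w` of the three forms, leaving the
integrand of `le_lintegral_quadrant`. Only the inclusion of the image in the simplex matters for a
lower bound. -/
theorem le_lintegral_formDensity {b₁ c₁ a₂ c₂ a₃ b₃ : ℝ} (hb₁ : 0 < b₁) (hc₁ : 0 < c₁)
    (ha₂ : 0 < a₂) (hc₂ : 0 < c₂) (ha₃ : 0 < a₃) (hb₃ : 0 < b₃) :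
    ENNReal.ofReal (Real.pi ^ 3 / 24) ≤
      ∫⁻ q in planeSimplex, ENNReal.ofReal (formDensity (vertexForms b₁ c₁ a₂ c₂ a₃ b₃) q) := by
  set N := vertexForms b₁ c₁ a₂ c₂ a₃ b₃ with hN
  -- These scalings make the second and third forms proportional to `1 + x.2` and `1 + x.1`.
  have hs : 0 < a₃ / b₃ := by positivity
  have ht : 0 < a₂ / c₂ := by positivity
  set s := a₃ / b₃ with hsdef
  set t := a₂ / c₂ with htdef
  have hw : ∀ x ∈ Ioi (0 : ℝ) ×ˢ Ioi (0 : ℝ), 0 < 1 + s * x.1 + t * x.2 := by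
    rintro x ⟨h1, h2⟩
    have h1 : 0 < x.1 := h1
    have h2 : 0 < x.2 := h2
    positivity
  have hsub : quadrantMap s t '' (Ioi (0 : ℝ) ×ˢ Ioi (0 : ℝ)) ⊆ planeSimplex := by
    rintro _ ⟨x, hx, rfl⟩
    exact quadrantMap_mem hs ht hx
  refine le_trans ?_ (lintegral_mono_set hsub)
  rw [lintegral_image_eq_lintegral_abs_det_fderiv_mul volume
    (measurableSet_Ioi.prod measurableSet_Ioi)
    (fun x hx => (hasFDerivAt_quadrantMap (hw x hx).ne').hasFDerivWithinAt)
    (injOn_quadrantMap hs ht)]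
  have hP : 0 < b₁ * c₂ * a₃ := by positivity
  have hQ : 0 < c₁ * a₂ * b₃ := by positivity
  have e : ∀ x ∈ Ioi (0 : ℝ) ×ˢ Ioi (0 : ℝ),
      ENNReal.ofReal |(quadrantMapDeriv s t x).det| *
        ENNReal.ofReal (formDensity N (quadrantMap s t x)) =
      ENNReal.ofReal (Real.pi / 12) * ENNReal.ofReal ((b₁ * c₂ * a₃ + c₁ * a₂ * b₃) /
        ((b₁ * c₂ * a₃ * x.1 + c₁ * a₂ * b₃ * x.2) * ((1 + x.1) * (1 + x.2)))) := by
    intro x hx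
    have hwx := hw x hx
    obtain ⟨h1, h2⟩ : 0 < x.1 ∧ 0 < x.2 := hx
    rw [← ENNReal.ofReal_mul (abs_nonneg _), ← ENNReal.ofReal_mul (by positivity),
      det_quadrantMapDeriv hwx.ne', abs_of_pos (by positivity)]
    congr 1
    set w := 1 + s * x.1 + t * x.2 with hwdef
    have f0 : affineForm N 0 (quadrantMap s t x) = (b₁ * s * x.1 + c₁ * t * x.2) / w := by
      simp [affineForm, quadrantMap, hN, vertexForms, ← hwdef]
      ring
    have f1 : affineForm N 1 (quadrantMap s t x) = a₂ * (1 + x.2) / w := by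
      have : affineForm N 1 (quadrantMap s t x) = (a₂ + c₂ * t * x.2) / w := by
        simp [affineForm, quadrantMap, hN, vertexForms, ← hwdef]
        field_simp
        rw [hwdef]
        ring
      rw [this, htdef]
      field_simp
    have f2 : affineForm N 2 (quadrantMap s t x) = a₃ * (1 + x.1) / w := by
      have : affineForm N 2 (quadrantMap s t x) = (a₃ + b₃ * s * x.1) / w := by
        simp [affineForm, quadrantMap, hN, vertexForms, ← hwdef]
        field_simp
        rw [hwdef]
        ring
      rw [this, hsdef]
      field_simp
    rw [formDensity, f0, f1, f2, hN, det_vertexForms, abs_of_pos (by positivity)]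
    have hst : b₁ * s * x.1 + c₁ * t * x.2 =
        (b₁ * c₂ * a₃ * x.1 + c₁ * a₂ * b₃ * x.2) / (b₃ * c₂) := by
      rw [hsdef, htdef]
      field_simp
    have hst2 : s * t = a₃ * a₂ / (b₃ * c₂) := by
      rw [hsdef, htdef]
      field_simp
    rw [hst, hst2]
    have : 0 < b₁ * c₂ * a₃ * x.1 + c₁ * a₂ * b₃ * x.2 := by positivity
    clear_value w
    field_simp
  rw [setLIntegral_congr_fun (measurableSet_Ioi.prod measurableSet_Ioi) e,
    lintegral_const_mul' _ _ ENNReal.ofReal_ne_top]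
  refine le_trans (le_of_eq ?_) (mul_le_mul_right (le_lintegral_quadrant hP hQ) _)
  rw [← ENNReal.ofReal_mul (by positivity)]
  congr 1
  ring

/-! ### The domain where three affine forms are positive -/

/-- The columns of `N⁻¹` are homogeneous coordinates of the vertices, and boundedness forces their
weights `E 0 j` to be positive. The barycentric coordinates of `q` are then `affineForm N j q * E 0
j`. -/
theorem isTriangularDomain_of_forms {N : Matrix (Fin 3) (Fin 3) ℝ} (hdet : N.det ≠ 0)
    (hne : {q | ∀ i, 0 < affineForm N i q}.Nonempty)
    (hb : Bornology.IsBounded {q | ∀ i, 0 < affineForm N i q}) :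
    IsTriangularDomain {q | ∀ i, 0 < affineForm N i q} := by
  obtain ⟨q₀, hq₀⟩ := hne
  have hu : IsUnit N.det := hdet.isUnit
  set E := N⁻¹ with hE
  have hNE : ∀ i j, N i 0 * E 0 j + N i 1 * E 1 j + N i 2 * E 2 j = if i = j then 1 else 0 := by
    intro i j
    have := congrFun (congrFun (Matrix.mul_nonsing_inv N hu) i) j
    rwa [Matrix.mul_apply, Fin.sum_univ_three, Matrix.one_apply] at this
  have hEN : ∀ i j, E i 0 * N 0 j + E i 1 * N 1 j + E i 2 * N 2 j = if i = j then 1 else 0 := by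
    intro i j
    have := congrFun (congrFun (Matrix.nonsing_inv_mul N hu) i) j
    rwa [Matrix.mul_apply, Fin.sum_univ_three, Matrix.one_apply] at this
  have hpos : ∀ j, 0 < E 0 j := by
    intro j
    by_contra! hs
    -- With a nonpositive weight, no form decreases along `v`, so the region would contain a ray.
    set v : ℝ × ℝ := (E 1 j - E 0 j * q₀.1, E 2 j - E 0 j * q₀.2) with hv
    have hslope : ∀ i, N i 1 * v.1 + N i 2 * v.2 =
        (if i = j then 1 else 0) + -E 0 j * affineForm N i q₀ := by
      intro i
      rw [← hNE i j, affineForm]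
      simp only [hv]
      ring
    have hslope0 : ∀ i, 0 ≤ N i 1 * v.1 + N i 2 * v.2 := by
      intro i
      rw [hslope]
      have := mul_nonneg (neg_nonneg.mpr hs) (hq₀ i).le
      split_ifs <;> linarith
    have hv0 : v ≠ 0 := by
      intro h0
      have h1 := hslope j
      rw [h0, if_pos rfl] at h1
      have := mul_nonneg (neg_nonneg.mpr hs) (hq₀ j).le
      simp only [Prod.fst_zero, Prod.snd_zero, mul_zero] at h1
      linarith
    have hvpos := norm_pos_iff.mpr hv0
    obtain ⟨R, hR⟩ := hb.subset_closedBall q₀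
    have hR0 : 0 ≤ R := by
      have := hR hq₀
      rwa [Metric.mem_closedBall, dist_self] at this
    have hmem : q₀ + ((R + 1) / ‖v‖) • v ∈ {q | ∀ i, 0 < affineForm N i q} := by
      intro i
      have : affineForm N i (q₀ + ((R + 1) / ‖v‖) • v) =
          affineForm N i q₀ + (R + 1) / ‖v‖ * (N i 1 * v.1 + N i 2 * v.2) := by
        simp [affineForm]
        ring
      rw [this]
      have := hslope0 i
      have := hq₀ i
      positivity
    have := hR hmem
    rw [Metric.mem_closedBall, dist_eq_norm, add_sub_cancel_left, norm_smul,
      Real.norm_of_nonneg (by positivity), div_mul_cancel₀ _ hvpos.ne'] at this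
    linarith
  set V : Fin 3 → ℝ × ℝ := fun j => (E 1 j / E 0 j, E 2 j / E 0 j) with hV
  have hform : ∀ i j, N i 0 + N i 1 * (V j).1 + N i 2 * (V j).2 =
      if i = j then 1 / E 0 j else 0 := by
    intro i j
    have h := hNE i j
    have := (hpos j).ne'
    simp only [hV]
    field_simp
    rw [h]
    split_ifs <;> simp [this]
  refine ⟨V 0, V 1, V 2, ?_, ?_⟩
  · rw [affineIndependent_iff_of_fintype]
    intro w hw hw0
    rw [Finset.weightedVSub_eq_linear_combination _ hw] at hw0
    rw [Fin.sum_univ_three] at hw hw0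
    have hx := congrArg Prod.fst hw0
    have hy := congrArg Prod.snd hw0
    simp at hx hy
    intro i
    have h1 : ∑ j, w j * (N i 0 + N i 1 * (V j).1 + N i 2 * (V j).2) = 0 := by
      rw [Fin.sum_univ_three]
      linear_combination N i 0 * hw + N i 1 * hx + N i 2 * hy
    simp only [hform, mul_ite, mul_zero, Finset.sum_ite_eq, Finset.mem_univ, if_true] at h1
    have := (hpos i).ne'
    simpa [this] using h1
  · ext q
    constructor
    · intro hq
      refine ⟨affineForm N 0 q * E 0 0, affineForm N 1 q * E 0 1, affineForm N 2 q * E 0 2,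
        mul_pos (hq 0) (hpos 0), mul_pos (hq 1) (hpos 1), mul_pos (hq 2) (hpos 2), ?_, ?_⟩
      · have h0 := hEN 0 0
        have h1 := hEN 0 1
        have h2 := hEN 0 2
        simp at h0 h1 h2
        simp only [affineForm]
        linear_combination h0 + q.1 * h1 + q.2 * h2
      · have e0 := (hpos 0).ne'
        have e1 := (hpos 1).ne'
        have e2 := (hpos 2).ne'
        ext
        · have h0 := hEN 1 0
          have h1 := hEN 1 1
          have h2 := hEN 1 2
          simp at h0 h1 h2
          simp only [hV, affineForm, Prod.fst_add, Prod.smul_fst, smul_eq_mul]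
          field_simp
          linear_combination -h0 - q.1 * h1 - q.2 * h2
        · have h0 := hEN 2 0
          have h1 := hEN 2 1
          have h2 := hEN 2 2
          simp at h0 h1 h2
          simp only [hV, affineForm, Prod.snd_add, Prod.smul_snd, smul_eq_mul]
          field_simp
          linear_combination -h0 - q.1 * h1 - q.2 * h2
    · rintro ⟨α, β, γ, hα, hβ, hγ, hsum, rfl⟩ i
      have : affineForm N i (α • V 0 + β • V 1 + γ • V 2) =
          α * (N i 0 + N i 1 * (V 0).1 + N i 2 * (V 0).2) +
          β * (N i 0 + N i 1 * (V 1).1 + N i 2 * (V 1).2) +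
          γ * (N i 0 + N i 1 * (V 2).1 + N i 2 * (V 2).2) := by
        simp only [affineForm, Prod.fst_add, Prod.snd_add, Prod.smul_fst, Prod.smul_snd,
          smul_eq_mul]
        linear_combination -N i 0 * hsum
      rw [this, hform, hform, hform]
      have := hpos 0
      have := hpos 1
      have := hpos 2
      fin_cases i <;> simp <;> positivity

/-- A ray cannot leave `C` later than it leaves the half-plane of the form, and `-logSlope` is the
inverse of that exit time when positive. -/
theorem neg_logSlope_le_gauge {C : Set (ℝ × ℝ)} (hC : IsConvexDomain C)
    {N : Matrix (Fin 3) (Fin 3) ℝ} (hN : ∀ q ∈ C, ∀ i, 0 < affineForm N i q) {p : ℝ × ℝ}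
    (hp : p ∈ C) (i : Fin 3) (v : ℝ × ℝ) :
    -logSlope N i p v ≤ gauge ((fun v => p + v) ⁻¹' C) v := by
  refine le_of_forall_gt fun r hr => ?_
  have hr0 : 0 < r := (gauge_nonneg _).trans_lt hr
  have h := ((hC.translate p).gauge_lt_iff (by simpa using hp) hr0).mp hr
  have h1 := hN _ h i
  rw [affineForm_add_smul _ _ (hN p hp i).ne', mul_pos_iff_of_pos_left (hN p hp i)] at h1
  have h2 : 0 < r * (1 + r⁻¹ * logSlope N i p v) := by positivity
  have e : r * (1 + r⁻¹ * logSlope N i p v) = r + logSlope N i p v := by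
    field_simp
  linarith

theorem eq_forms_of_volume_le {C : Set (ℝ × ℝ)} (hC : IsConvexDomain C)
    {N : Matrix (Fin 3) (Fin 3) ℝ} (hN : ∀ q ∈ C, ∀ i, 0 < affineForm N i q) {p : ℝ × ℝ}
    (hp : p ∈ C)
    (hfin : volume {v : ℝ × ℝ | ∀ i j, logSlope N i p v - logSlope N j p v < 2} ≠ ∞)
    (hle : volume {v : ℝ × ℝ | ∀ i j, logSlope N i p v - logSlope N j p v < 2} ≤
      volume (finslerBall C p)) :
    C = {q | ∀ i, 0 < affineForm N i q} := by
  refine Subset.antisymm hN fun q hq => ?_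
  by_contra hqC
  set H := {v : ℝ × ℝ | ∀ i j, logSlope N i p v - logSlope N j p v < 2} with hH
  have hBH := finslerBall_subset_logSlope hC hN hp
  have hF := continuous_finsler hC hp
  set U := {v : ℝ × ℝ | 1 < finsler C p v} ∩ H with hU
  have hHo : IsOpen H := by
    simp only [hH, ofPred_forall]
    exact isOpen_iInter_of_finite fun i => isOpen_iInter_of_finite fun j =>
      isOpen_lt ((continuous_logSlope N i p).sub (continuous_logSlope N j p)) continuous_const
  have hUo : IsOpen U := (isOpen_lt continuous_const hF).inter hHo
  have hUne : U.Nonempty := by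
    set v := q - p with hv
    have hg : 1 ≤ gauge ((fun v => p + v) ⁻¹' C) v := by
      by_contra! h
      have := ((hC.translate p).gauge_lt_iff (by simpa using hp) one_pos).mp h
      exact hqC (by simpa [hv] using this)
    have hg' := gauge_nonneg (s := (fun v => p + v) ⁻¹' C) (-v)
    have hFv := finsler_eq_gauge hC hp v
    have hFpos : 0 < finsler C p v := by linarith
    -- As `q` lies in the region of the forms, `-l_j < 1 ≤ g(v)`, while `l_i ≤ g(-v)`; the sum is `2
    -- F`. So the point of the ray where `F = 1` lies strictly inside the open hexagon, and slightly
    -- beyond it one is still inside.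
    have hlt : ∀ i j, (finsler C p v)⁻¹ * (logSlope N i p v - logSlope N j p v) < 2 := by
      intro i j
      have h1 := neg_logSlope_le_gauge hC hN hp i (-v)
      have h2 : logSlope N i p (-v) = -logSlope N i p v := by
        have := logSlope_smul N i p (-1) v
        simpa using this
      have h3 := affineForm_add_smul N j (hN p hp j).ne' 1 v
      rw [one_smul, hv, add_sub_cancel, ← hv] at h3
      have h4 := hq j
      rw [h3, mul_pos_iff_of_pos_left (hN p hp j)] at h4
      rw [inv_mul_lt_iff₀ hFpos]
      linarith
    have hev : ∀ᶠ c in 𝓝[>] (finsler C p v)⁻¹,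
        ∀ i j, c * (logSlope N i p v - logSlope N j p v) < 2 := by
      refine eventually_all.mpr fun i => eventually_all.mpr fun j => ?_
      have hc : Continuous fun c : ℝ => c * (logSlope N i p v - logSlope N j p v) := by fun_prop
      exact (hc.tendsto _).eventually (gt_mem_nhds (hlt i j)) |>.filter_mono nhdsWithin_le_nhds
    obtain ⟨c, hc, hc1⟩ := (hev.and self_mem_nhdsWithin).exists
    have hc1 : (finsler C p v)⁻¹ < c := hc1
    have hc0 : 0 < c := (inv_pos.mpr hFpos).trans hc1
    refine ⟨c • v, ?_, fun i j => ?_⟩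
    · rw [mem_ofPred_eq, finsler_smul hC hp hc0.le]
      exact (inv_lt_iff_one_lt_mul₀ hFpos).mp hc1
    · rw [logSlope_smul, logSlope_smul, ← mul_sub]
      exact hc i j
  have hdisj : Disjoint (finslerBall C p) U := by
    rw [disjoint_left]
    intro v hvB hvU
    exact lt_asymm (show finsler C p v < 1 from hvB) hvU.1
  have h1 := measure_union hdisj hUo.measurableSet (μ := volume)
  have h2 : volume (finslerBall C p ∪ U) ≤ volume (finslerBall C p) :=
    (measure_mono (union_subset hBH inter_subset_right)).trans hle
  rw [h1] at h2
  have hBfin : volume (finslerBall C p) ≠ ∞ := ((measure_mono hBH).trans_lt hfin.lt_top).ne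
  have h3 : volume U ≤ 0 := by
    rw [← add_zero (volume (finslerBall C p))] at h2
    nth_rewrite 1 [add_zero] at h2
    exact (ENNReal.add_le_add_iff_left hBfin).mp h2
  exact (hUo.measure_pos volume hUne).not_ge h3

/-! ### Ideal triangles in the plane -/

theorem exists_supporting_form {C : Set (ℝ × ℝ)} (hC : IsConvexDomain C) {x : ℝ × ℝ}
    (hx : x ∉ C) :
    ∃ k m n : ℝ, (∀ q ∈ C, 0 < k + m * q.1 + n * q.2) ∧ k + m * x.1 + n * x.2 = 0 := by
  obtain ⟨f, hf⟩ := geometric_hahn_banach_open_point hC.convex hC.isOpen hx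
  have hfq : ∀ q : ℝ × ℝ, f q = f (1, 0) * q.1 + f (0, 1) * q.2 := by
    intro q
    have : q = q.1 • ((1, 0) : ℝ × ℝ) + q.2 • ((0, 1) : ℝ × ℝ) := by
      ext <;> simp
    have := congrArg f this
    rw [map_add, map_smul, map_smul, smul_eq_mul, smul_eq_mul] at this
    linarith
  refine ⟨f x, -f (1, 0), -f (0, 1), fun q hq => ?_, ?_⟩
  · have := hf q hq
    rw [hfq q] at this
    linarith
  · have := hfq x
    linarith

theorem vertex_values_nonneg {k m n : ℝ} (h : ∀ q ∈ planeSimplex, 0 < k + m * q.1 + n * q.2) :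
    0 ≤ k ∧ 0 ≤ k + m ∧ 0 ≤ k + n := by
  have hcl : closure planeSimplex ⊆ {q : ℝ × ℝ | 0 ≤ k + m * q.1 + n * q.2} :=
    closure_minimal (fun q hq => (h q hq).le) (isClosed_le continuous_const (by fun_prop))
  have h0 := hcl (mem_closure_planeSimplex (q := (0, 0)) (by simp) (by simp) (by simp))
  have h1 := hcl (mem_closure_planeSimplex (q := (1, 0)) (by simp) (by simp) (by simp))
  have h2 := hcl (mem_closure_planeSimplex (q := (0, 1)) (by simp) (by simp) (by simp))
  simp at h0 h1 h2
  exact ⟨h0, h1, h2⟩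

/-- Complete the form of the side by two parallel forms `M ± x` along a coordinate: all are positive
on `C`, and the latter two are bounded there. The density then dominates a multiple of the inverse
of the side form, whose integral diverges logarithmically. -/
theorem lintegral_planeDensity_eq_top {C : Set (ℝ × ℝ)} (hC : IsConvexDomain C)
    (hS : planeSimplex ⊆ C)
    (hside : (∀ q ∈ C, 0 < q.2) ∨ (∀ q ∈ C, 0 < q.1) ∨ (∀ q ∈ C, 0 < 1 - q.1 - q.2)) :
    ∫⁻ q in planeSimplex, planeDensity C q = ∞ := by
  obtain ⟨M, hM0, hM⟩ := hC.isBounded.exists_pos_norm_lt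
  have hcoord : ∀ q ∈ C, (-M < q.1 ∧ q.1 < M) ∧ (-M < q.2 ∧ q.2 < M) := fun q hq =>
    ⟨abs_lt.mp ((norm_fst_le q).trans_lt (hM q hq)), abs_lt.mp ((norm_snd_le q).trans_lt (hM q hq))⟩
  have key : ∀ N : Matrix (Fin 3) (Fin 3) ℝ, N.det ≠ 0 → (∀ q ∈ C, ∀ i, 0 < affineForm N i q) →
      (∀ q ∈ C, affineForm N 1 q ≤ 2 * M) → (∀ q ∈ C, affineForm N 2 q ≤ 2 * M) →
      ∫⁻ q in planeSimplex, ENNReal.ofReal (affineForm N 0 q)⁻¹ = ∞ →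
      ∫⁻ q in planeSimplex, planeDensity C q = ∞ := by
    intro N hdet hN h1 h2 htop
    rw [eq_top_iff, ← lintegral_formDensity_eq_top hdet (fun q hq => hN q (hS hq))
      (fun q hq => h1 q (hS hq)) (fun q hq => h2 q (hS hq)) htop]
    exact setLIntegral_mono' isOpen_planeSimplex.measurableSet fun q hq =>
      formDensity_le_planeDensity hC hdet hN (hS hq)
  rcases hside with h | h | h
  · refine key !![0, 0, 1; M, 1, 0; M, -1, 0] ?_ ?_ ?_ ?_ ?_
    · rw [Matrix.det_fin_three]
      simp
      linarith
    · intro q hq i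
      have := hcoord q hq
      have := h q hq
      fin_cases i <;> simp [affineForm] <;> linarith
    · intro q hq
      have := hcoord q hq
      simp [affineForm]
      linarith
    · intro q hq
      have := hcoord q hq
      simp [affineForm]
      linarith
    · simpa [affineForm] using lintegral_simplex_inv_snd
  · refine key !![0, 1, 0; M, 0, 1; M, 0, -1] ?_ ?_ ?_ ?_ ?_
    · rw [Matrix.det_fin_three]
      simp
      linarith
    · intro q hq i
      have := hcoord q hq
      have := h q hq
      fin_cases i <;> simp [affineForm] <;> linarith
    · intro q hq
      have := hcoord q hq
      simp [affineForm]
      linarith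
    · intro q hq
      have := hcoord q hq
      simp [affineForm]
      linarith
    · simpa [affineForm] using lintegral_simplex_inv_fst
  · refine key !![1, -1, -1; M, 1, 0; M, -1, 0] ?_ ?_ ?_ ?_ ?_
    · rw [Matrix.det_fin_three]
      simp
      linarith
    · intro q hq i
      have := hcoord q hq
      have := h q hq
      fin_cases i <;> simp [affineForm] <;> linarith
    · intro q hq
      have := hcoord q hq
      simp [affineForm]
      linarith
    · intro q hq
      have := hcoord q hq
      simp [affineForm]
      linarith
    · simpa [affineForm, sub_eq_add_neg] using lintegral_simplex_inv_one_sub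

theorem plane_ideal_triangle_of_forms {C : Set (ℝ × ℝ)} (hC : IsConvexDomain C)
    (hS : planeSimplex ⊆ C) {b₁ c₁ a₂ c₂ a₃ b₃ : ℝ} (hb₁ : 0 < b₁) (hc₁ : 0 < c₁)
    (ha₂ : 0 < a₂) (hc₂ : 0 < c₂) (ha₃ : 0 < a₃) (hb₃ : 0 < b₃)
    (hN : ∀ q ∈ C, ∀ i, 0 < affineForm (vertexForms b₁ c₁ a₂ c₂ a₃ b₃) i q) :
    ENNReal.ofReal (Real.pi ^ 3 / 24) ≤ ∫⁻ q in planeSimplex, planeDensity C q ∧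
      (∫⁻ q in planeSimplex, planeDensity C q = ENNReal.ofReal (Real.pi ^ 3 / 24) →
        IsTriangularDomain C) := by
  have hm := isOpen_planeSimplex.measurableSet
  have hlow := le_lintegral_formDensity hb₁ hc₁ ha₂ hc₂ ha₃ hb₃
  have hdet : (vertexForms b₁ c₁ a₂ c₂ a₃ b₃).det ≠ 0 := by
    rw [det_vertexForms]
    positivity
  set N := vertexForms b₁ c₁ a₂ c₂ a₃ b₃
  have hle : ∀ q ∈ planeSimplex, ENNReal.ofReal (formDensity N q) ≤ planeDensity C q :=
    fun q hq => formDensity_le_planeDensity hC hdet hN (hS hq)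
  refine ⟨hlow.trans (setLIntegral_mono' hm hle), fun heq => ?_⟩
  have hae : ∀ᵐ q ∂volume.restrict planeSimplex,
      ENNReal.ofReal (formDensity N q) = planeDensity C q := by
    refine ae_eq_of_ae_le_of_lintegral_le ((ae_restrict_iff' hm).mpr (Eventually.of_forall hle))
      (ne_top_of_le_ne_top ?_ (setLIntegral_mono' hm hle))
      ((aemeasurable_planeDensity hC).mono_measure (Measure.restrict_mono hS le_rfl)) ?_
    · rw [heq]
      exact ENNReal.ofReal_ne_top
    · rw [heq]
      exact hlow
  have hne : (volume.restrict planeSimplex) ≠ 0 := by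
    rw [Ne, Measure.restrict_eq_zero]
    exact (isOpen_planeSimplex.measure_pos _ ⟨(1 / 3, 1 / 3), by norm_num [planeSimplex]⟩).ne'
  have : (ae (volume.restrict planeSimplex)).NeBot := ae_neBot.mpr hne
  obtain ⟨p, hp, hpS⟩ := (hae.and (ae_restrict_mem hm)).exists
  have hpC := hS hpS
  -- Equality squeezes `π / vol H` between the density bound and the density of `C`.
  have hHB : volume {v : ℝ × ℝ | ∀ i j, logSlope N i p v - logSlope N j p v < 2} =
      volume (finslerBall C p) := by
    have h1 := formDensity_le_div hdet (hN p hpC)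
    rw [hp, planeDensity] at h1
    have h2 := ENNReal.div_le_div_left
      (measure_mono (finslerBall_subset_logSlope hC hN hpC) (μ := volume))
      (ENNReal.ofReal Real.pi)
    have h3 := h1.antisymm h2
    rw [div_eq_mul_inv, div_eq_mul_inv, ENNReal.mul_right_inj
      (ENNReal.ofReal_pos.mpr Real.pi_pos).ne' ENNReal.ofReal_ne_top, inv_inj] at h3
    exact h3.symm
  have hfin := ((volume_logSlope_le hdet (hN p hpC)).trans_lt ENNReal.ofReal_lt_top).ne
  have hCeq := eq_forms_of_volume_le hC hN hpC hfin hHB.le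
  rw [hCeq]
  exact isTriangularDomain_of_forms hdet (hCeq ▸ hC.nonempty) (hCeq ▸ hC.isBounded)

theorem plane_ideal_triangle {C : Set (ℝ × ℝ)} (hC : IsConvexDomain C) (hS : planeSimplex ⊆ C)
    (h0 : (0, 0) ∉ C) (h1 : (1, 0) ∉ C) (h2 : (0, 1) ∉ C) :
    ENNReal.ofReal (Real.pi ^ 3 / 24) ≤ ∫⁻ q in planeSimplex, planeDensity C q ∧
      (∫⁻ q in planeSimplex, planeDensity C q = ENNReal.ofReal (Real.pi ^ 3 / 24) →
        IsTriangularDomain C) := by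
  have hside : ((∀ q ∈ C, 0 < q.2) ∨ (∀ q ∈ C, 0 < q.1) ∨ (∀ q ∈ C, 0 < 1 - q.1 - q.2)) →
      ENNReal.ofReal (Real.pi ^ 3 / 24) ≤ ∫⁻ q in planeSimplex, planeDensity C q ∧
      (∫⁻ q in planeSimplex, planeDensity C q = ENNReal.ofReal (Real.pi ^ 3 / 24) →
        IsTriangularDomain C) := by
    intro h
    rw [lintegral_planeDensity_eq_top hC hS h]
    exact ⟨le_top, fun h => absurd h.symm ENNReal.ofReal_ne_top⟩
  obtain ⟨k₁, m₁, n₁, hp₁, hv₁⟩ := exists_supporting_form hC h0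
  obtain ⟨k₂, m₂, n₂, hp₂, hv₂⟩ := exists_supporting_form hC h1
  obtain ⟨k₃, m₃, n₃, hp₃, hv₃⟩ := exists_supporting_form hC h2
  simp only [mul_zero, mul_one, add_zero] at hv₁ hv₂ hv₃
  obtain ⟨-, hb₁, hc₁⟩ := vertex_values_nonneg fun q hq => hp₁ q (hS hq)
  obtain ⟨ha₂, -, hc₂⟩ := vertex_values_nonneg fun q hq => hp₂ q (hS hq)
  obtain ⟨ha₃, hb₃, -⟩ := vertex_values_nonneg fun q hq => hp₃ q (hS hq)
  -- A supporting form that vanishes at a second vertex is a multiple of the form of a side; each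
  -- such case has infinite area.
  rcases hb₁.eq_or_lt with hb₁ | hb₁
  · refine hside (.inl fun q hq => ?_)
    have := hp₁ q hq
    have hm : m₁ = 0 := by linarith
    rw [hv₁, hm, zero_mul, zero_add, zero_add] at this
    exact pos_of_mul_pos_right this (by linarith)
  rcases hc₁.eq_or_lt with hc₁ | hc₁
  · refine hside (.inr (.inl fun q hq => ?_))
    have := hp₁ q hq
    have hn : n₁ = 0 := by linarith
    rw [hv₁, hn, zero_mul, add_zero, zero_add] at this
    exact pos_of_mul_pos_right this (by linarith)
  rcases ha₂.eq_or_lt with ha₂ | ha₂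
  · refine hside (.inl fun q hq => ?_)
    have := hp₂ q hq
    have hm : m₂ = 0 := by linarith
    rw [← ha₂, hm, zero_mul, zero_add, zero_add] at this
    exact pos_of_mul_pos_right this (by linarith)
  rcases hc₂.eq_or_lt with hc₂ | hc₂
  · refine hside (.inr (.inr fun q hq => ?_))
    have := hp₂ q hq
    have hm : m₂ = -k₂ := by linarith
    have hn : n₂ = -k₂ := by linarith
    rw [hm, hn] at this
    have e : k₂ + -k₂ * q.1 + -k₂ * q.2 = k₂ * (1 - q.1 - q.2) := by ring
    rw [e] at this
    exact pos_of_mul_pos_right this (by linarith)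
  rcases ha₃.eq_or_lt with ha₃ | ha₃
  · refine hside (.inr (.inl fun q hq => ?_))
    have := hp₃ q hq
    have hn : n₃ = 0 := by linarith
    rw [← ha₃, hn, zero_mul, add_zero, zero_add] at this
    exact pos_of_mul_pos_right this (by linarith)
  rcases hb₃.eq_or_lt with hb₃ | hb₃
  · refine hside (.inr (.inr fun q hq => ?_))
    have := hp₃ q hq
    have hm : m₃ = -k₃ := by linarith
    have hn : n₃ = -k₃ := by linarith
    rw [hm, hn] at this
    have e : k₃ + -k₃ * q.1 + -k₃ * q.2 = k₃ * (1 - q.1 - q.2) := by ring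
    rw [e] at this
    exact pos_of_mul_pos_right this (by linarith)
  refine plane_ideal_triangle_of_forms hC hS hb₁ hc₁ ha₂ hc₂ ha₃ hb₃ fun q hq i => ?_
  have e₁ := hp₁ q hq
  have e₂ := hp₂ q hq
  have e₃ := hp₃ q hq
  have hm₂ : m₂ = -k₂ := by linarith
  have hn₃ : n₃ = -k₃ := by linarith
  fin_cases i
  · simpa [affineForm, vertexForms, hv₁] using e₁
  · simpa [affineForm, vertexForms, hm₂] using e₂
  · simpa [affineForm, vertexForms, hn₃] using e₃

/-! ### Transfer to a two-dimensional inner product space -/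

section Transfer

variable {E : Type*} [NormedAddCommGroup E] [InnerProductSpace ℝ E] [FiniteDimensional ℝ E]
  [MeasurableSpace E] [BorelSpace E]

/-- A linear isomorphism rescales Lebesgue measure by a constant `κ`, which cancels between the
measure and the volume of the ball in the density. The normalisation `ω` is `π` because `E` has
dimension two. -/
theorem hilbertMeasure_image {C : Set E} (hC : IsConvexDomain C) (L : (ℝ × ℝ) ≃L[ℝ] E)
    {S : Set (ℝ × ℝ)} (hS : MeasurableSet S) (hSC : S ⊆ L ⁻¹' C) :
    hilbertMeasure C (L '' S) = ∫⁻ q in S, planeDensity (L ⁻¹' C) q := by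
  have hdim : Module.finrank ℝ E = 2 := by
    rw [← L.toLinearEquiv.finrank_eq, Module.finrank_prod, Module.finrank_self]
  have : Nontrivial E := Module.nontrivial_of_finrank_pos (R := ℝ) (by omega)
  have hball : volume (Metric.ball (0 : E) 1) = ENNReal.ofReal Real.pi := by
    rw [InnerProductSpace.volume_ball_of_dim_even (k := 1) (by omega)]
    simp
  have hLe : MeasurableEmbedding L := L.toHomeomorph.measurableEmbedding
  have hLS : MeasurableSet (L '' S) := hLe.measurableSet_image.mpr hS
  have hsub : L '' S ⊆ C := image_subset_iff.mpr hSC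
  obtain ⟨κ, hκ⟩ : ∃ κ : ℝ≥0∞, κ ≠ 0 ∧ κ ≠ ∞ ∧
      (volume : Measure E) = κ • Measure.map L (volume : Measure (ℝ × ℝ)) := by
    have : (Measure.map L (volume : Measure (ℝ × ℝ))).IsAddHaarMeasure :=
      L.isAddHaarMeasure_map _
    refine ⟨Measure.addHaarScalarFactor (volume : Measure E) (Measure.map L volume), ?_, ?_, ?_⟩
    · exact_mod_cast (Measure.addHaarScalarFactor_pos_of_isAddHaarMeasure _ _).ne'
    · exact ENNReal.coe_ne_top
    · exact Measure.isAddLeftInvariant_eq_smul _ _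
  obtain ⟨hκ0, hκt, hvol⟩ := hκ
  have hmeas : ∀ s : Set E, volume s = κ * volume (L ⁻¹' s) := by
    intro s
    rw [hvol, Measure.smul_apply, smul_eq_mul, hLe.map_apply]
  rw [hilbertMeasure, withDensity_apply _ hLS, Measure.restrict_restrict hLS,
    inter_eq_self_of_subset_left hsub, hball]
  have hrestr : (volume : Measure E).restrict (L '' S) =
      κ • Measure.map L ((volume : Measure (ℝ × ℝ)).restrict S) := by
    rw [hvol, Measure.restrict_smul, hLe.restrict_map, preimage_image_eq _ L.injective]
  rw [hrestr, lintegral_smul_measure, hLe.lintegral_map, smul_eq_mul,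
    ← lintegral_const_mul' _ _ hκt]
  refine setLIntegral_congr_fun hS fun q hq => ?_
  simp only [planeDensity]
  rw [finslerBall_preimage hC L (hSC hq), hmeas, div_eq_mul_inv, div_eq_mul_inv,
    ENNReal.mul_inv (.inl hκ0) (.inl hκt), mul_left_comm, ← mul_assoc κ,
    ENNReal.mul_inv_cancel hκ0 hκt, one_mul]

end Transfer

/-! ### Affine images of triangles and coordinates adapted to a triangle. -/

theorem image_openTriangle {E F : Type*} [AddCommGroup E] [Module ℝ E] [AddCommGroup F]
    [Module ℝ F] (f : E →ᵃ[ℝ] F) (a b c : E) :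
    f '' openTriangle a b c = openTriangle (f a) (f b) (f c) := by
  have key : ∀ α β γ : ℝ, α + β + γ = 1 →
      f (α • a + β • b + γ • c) = α • f a + β • f b + γ • f c := by
    intro α β γ h
    have e : ∀ x, f x = f.linear x + f 0 := fun x => by
      simpa using f.map_vadd 0 x
    rw [e, e a, e b, e c, map_add, map_add, map_smul, map_smul, map_smul]
    have : f 0 = α • f 0 + β • f 0 + γ • f 0 := by
      rw [← add_smul, ← add_smul, h, one_smul]
    conv_lhs => rw [this]
    simp only [smul_add]
    abel
  ext y
  constructor
  · rintro ⟨_, ⟨α, β, γ, hα, hβ, hγ, h, rfl⟩, rfl⟩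
    exact ⟨α, β, γ, hα, hβ, hγ, h, key α β γ h⟩
  · rintro ⟨α, β, γ, hα, hβ, hγ, h, rfl⟩
    exact ⟨_, ⟨α, β, γ, hα, hβ, hγ, h, rfl⟩, key α β γ h⟩

theorem IsTriangularDomain.image {E F : Type*} [NormedAddCommGroup E] [NormedSpace ℝ E]
    [NormedAddCommGroup F] [NormedSpace ℝ F] {C : Set E} (hC : IsTriangularDomain C)
    (f : E →ᵃ[ℝ] F) (hf : Function.Injective f) : IsTriangularDomain (f '' C) := by
  obtain ⟨a, b, c, h, rfl⟩ := hC
  refine ⟨f a, f b, f c, ?_, image_openTriangle f a b c⟩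
  have := h.map' f hf
  convert! this using 1
  ext i
  fin_cases i <;> rfl

theorem planeSimplex_eq_openTriangle :
    planeSimplex = openTriangle ((0, 0) : ℝ × ℝ) (1, 0) (0, 1) := by
  ext ⟨y, z⟩
  constructor
  · rintro ⟨hy, hz, h⟩
    exact ⟨1 - y - z, y, z, by simp only at h; linarith, hy, hz, by ring, by simp⟩
  · rintro ⟨α, β, γ, hα, hβ, hγ, h, he⟩
    simp at he
    obtain ⟨rfl, rfl⟩ := he
    exact ⟨hβ, hγ, by simp only; linarith⟩

theorem IsConvexDomain.planeSection {E : Type*} [NormedAddCommGroup E] [NormedSpace ℝ E]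
    {C : Set E} (hC : IsConvexDomain C) (P : AffineSubspace ℝ E) (o : E)
    (hne : (planeSection P o C).Nonempty) : IsConvexDomain (planeSection P o C) where
  nonempty := hne
  isOpen := hC.isOpen.preimage (by fun_prop : Continuous fun v : P.direction => o + (v : E))
  convex := (hC.translate o).convex.linear_preimage P.direction.subtype
  isBounded := by
    obtain ⟨R, hR⟩ := (hC.translate o).isBounded.subset_closedBall 0
    refine (Metric.isBounded_closedBall (x := (0 : P.direction)) (r := R)).subset fun v hv => ?_
    simpa [dist_eq_norm] using hR (show (v : E) ∈ (fun v => o + v) ⁻¹' C from hv)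

theorem exists_triangle_coordinates {E : Type*} [NormedAddCommGroup E] [NormedSpace ℝ E]
    {a b c : E} (h : AffineIndependent ℝ ![a, b, c]) :
    ∃ L : (ℝ × ℝ) ≃L[ℝ] (affineSpan ℝ {a, b, c}).direction,
      ∀ q : ℝ × ℝ, (L q : E) = q.1 • (b - a) + q.2 • (c - a) := by
  set P := affineSpan ℝ {a, b, c} with hP
  have hdim : Module.finrank ℝ P.direction = 2 := by
    have hr : Set.range ![a, b, c] = {a, b, c} := by
      simp [Matrix.range_cons]
      aesop
    have := h.finrank_vectorSpan (n := 2) (by simp)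
    rwa [hr, ← direction_affineSpan] at this
  have ha : a ∈ P := subset_affineSpan ℝ _ (by simp)
  have hb : b ∈ P := subset_affineSpan ℝ _ (by simp)
  have hc : c ∈ P := subset_affineSpan ℝ _ (by simp)
  let u : P.direction := ⟨b - a, AffineSubspace.vsub_mem_direction hb ha⟩
  let v : P.direction := ⟨c - a, AffineSubspace.vsub_mem_direction hc ha⟩
  let f : ℝ × ℝ →ₗ[ℝ] P.direction :=
    (LinearMap.fst ℝ ℝ ℝ).smulRight u + (LinearMap.snd ℝ ℝ ℝ).smulRight v
  have hf : ∀ q : ℝ × ℝ, (f q : E) = q.1 • (b - a) + q.2 • (c - a) := fun q => by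
    simp [f, u, v]
  have hinj : Function.Injective f := by
    rw [injective_iff_map_eq_zero]
    rintro ⟨y, z⟩ h0
    have h1 : y • (b - a) + z • (c - a) = 0 := by
      rw [← hf (y, z), h0]
      rfl
    rw [affineIndependent_iff_of_fintype] at h
    -- The weights on `a`, `b`, `c` that express the linear relation as an affine one.
    have hw : ∑ i, (![-(y + z), y, z] : Fin 3 → ℝ) i = 0 := by
      simp [Fin.sum_univ_three]
    have := h ![-(y + z), y, z] hw (by
      rw [Finset.weightedVSub_eq_linear_combination _ hw, Fin.sum_univ_three]
      simp only [Matrix.cons_val]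
      rw [← h1]
      module)
    have h2 := this 1
    have h3 := this 2
    simp at h2 h3
    simp [h2, h3]
  have : FiniteDimensional ℝ P.direction := Module.finite_of_finrank_pos (by omega)
  refine ⟨(LinearMap.linearEquivOfInjective f hinj ?_).toContinuousLinearEquiv, hf⟩
  rw [hdim, Module.finrank_prod, Module.finrank_self]

section IdealTriangle

variable {E : Type*} [NormedAddCommGroup E] [InnerProductSpace ℝ E] [FiniteDimensional ℝ E]
  [MeasurableSpace E] [BorelSpace E]

theorem triangleArea_ideal {C : Set E} (hC : IsConvexDomain C) {a b c : E}
    (h : IsIdealTriangle C a b c) :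
    ENNReal.ofReal (Real.pi ^ 3 / 24) ≤ triangleArea C a b c ∧
      (triangleArea C a b c = ENNReal.ofReal (Real.pi ^ 3 / 24) →
        IsTriangularDomain (planeSection (affineSpan ℝ {a, b, c}) a C)) := by
  obtain ⟨L, hL⟩ := exists_triangle_coordinates h.affineIndependent
  let g : ℝ × ℝ →ᵃ[ℝ] E :=
    (AffineEquiv.constVAdd ℝ E a).toAffineMap.comp
      ((affineSpan ℝ {a, b, c}).direction.subtype.toAffineMap.comp
        L.toLinearEquiv.toLinearMap.toAffineMap)
  have hg : ∀ q, g q = a + (L q : E) := fun q => rfl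
  have hg0 : g (0, 0) = a := by simp [hg, hL]
  have hg1 : g (1, 0) = b := by simp [hg, hL]
  have hg2 : g (0, 1) = c := by simp [hg, hL]
  have himage : g '' planeSimplex = openTriangle a b c := by
    rw [planeSimplex_eq_openTriangle, image_openTriangle, hg0, hg1, hg2]
  have hT : planeSection (affineSpan ℝ {a, b, c}) a (openTriangle a b c) = L '' planeSimplex := by
    ext v
    rw [← himage]
    constructor
    · rintro ⟨q, hq, hqv⟩
      rw [hg, add_right_inj] at hqv
      exact ⟨q, hq, Subtype.ext hqv⟩
    · rintro ⟨q, hq, rfl⟩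
      exact ⟨q, hq, rfl⟩
  have hS : planeSimplex ⊆ L ⁻¹' planeSection (affineSpan ℝ {a, b, c}) a C := by
    intro q hq
    exact h.subset (himage ▸ mem_image_of_mem g hq)
  have hS0 : ((1 / 3, 1 / 3) : ℝ × ℝ) ∈ planeSimplex := by norm_num [planeSimplex]
  have hD := hC.planeSection (affineSpan ℝ {a, b, c}) a ⟨L (1 / 3, 1 / 3), hS hS0⟩
  have hfr : ∀ x ∈ frontier C, x ∉ C := fun x hx hxC => by
    rw [hC.isOpen.frontier_eq] at hx
    exact hx.2 hxC
  have key := plane_ideal_triangle (hD.preimage L) hS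
    (fun hx => hfr a h.left_mem (hg0 ▸ (show g (0, 0) ∈ C from hx)))
    (fun hx => hfr b h.middle_mem (hg1 ▸ (show g (1, 0) ∈ C from hx)))
    (fun hx => hfr c h.right_mem (hg2 ▸ (show g (0, 1) ∈ C from hx)))
  have harea : triangleArea C a b c =
      ∫⁻ q in planeSimplex, planeDensity (L ⁻¹' planeSection (affineSpan ℝ {a, b, c}) a C) q := by
    rw [triangleArea, hT, hilbertMeasure_image hD L isOpen_planeSimplex.measurableSet hS]
  rw [harea]
  refine ⟨key.1, fun heq => ?_⟩
  have := (key.2 heq).image L.toLinearEquiv.toLinearMap.toAffineMap L.injective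
  convert! this using 1
  exact (image_preimage_eq _ L.surjective).symm

end IdealTriangle

theorem isTriangularDomain_of_planeSection {E : Type*} [NormedAddCommGroup E]
    [NormedSpace ℝ E] {C : Set E} {a b c : E}
    (htop : (affineSpan ℝ {a, b, c}).direction = ⊤)
    (h : IsTriangularDomain (planeSection (affineSpan ℝ {a, b, c}) a C)) :
    IsTriangularDomain C := by
  set P := affineSpan ℝ {a, b, c}
  let g : P.direction →ᵃ[ℝ] E :=
    (AffineEquiv.constVAdd ℝ E a).toAffineMap.comp P.direction.subtype.toAffineMap
  have hg : ∀ v, g v = a + (v : E) := fun q => rfl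
  have hinj : Function.Injective g := fun x y hxy => by
    rw [hg, hg, add_right_inj] at hxy
    exact Subtype.ext hxy
  convert! h.image g hinj using 1
  ext x
  constructor
  · intro hx
    refine ⟨⟨x - a, htop ▸ Submodule.mem_top⟩, ?_, ?_⟩
    · simpa [planeSection] using hx
    · simp [hg]
  · rintro ⟨v, hv, rfl⟩
    exact hv

end HilbertGeometry

theorem mainTheorem2 (n : ℕ) (C : Set (EuclideanSpace ℝ (Fin n)))
    (hC : HilbertGeometry.IsConvexDomain C) :
    (∀ a b c : EuclideanSpace ℝ (Fin n), HilbertGeometry.IsIdealTriangle C a b c →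
      ENNReal.ofReal (Real.pi ^ 3 / 24) ≤ HilbertGeometry.triangleArea C a b c) ∧
    (n = 2 →
      (∃ a b c : EuclideanSpace ℝ (Fin n), HilbertGeometry.IsIdealTriangle C a b c ∧
        HilbertGeometry.triangleArea C a b c = ENNReal.ofReal (Real.pi ^ 3 / 24)) →
      HilbertGeometry.IsTriangularDomain C) := by
  refine ⟨fun a b c h => (HilbertGeometry.triangleArea_ideal hC h).1, ?_⟩
  rintro hn ⟨a, b, c, h, heq⟩
  refine HilbertGeometry.isTriangularDomain_of_planeSection ?_
    ((HilbertGeometry.triangleArea_ideal hC h).2 heq)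
  obtain ⟨L, -⟩ := HilbertGeometry.exists_triangle_coordinates h.affineIndependent
  -- For `n = 2` the plane of the triangle is the whole space, so the section is a translate of `C`.
  apply Submodule.eq_top_of_finrank_eq
  rw [← L.toLinearEquiv.finrank_eq, Module.finrank_prod, Module.finrank_self,
    finrank_euclideanSpace_fin, hn]
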